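/- Let $t_a,t_b\ge 1$ be coprime integers, let $n\ge 1$, and put $A=nt_a$, $B=nt_b$, $m=A+B=n(t_a+t_b)$. A configuration $c$ is a lattice path $(c_0,\dots,c_m)$ from $c_0=(0,0)$ to $c_m=(A,B)$ whose steps are $a=(1,0)$ or $b=(0,1)$; its word is $w_1\cdots w_m$ with $w_i=c_i-c_{i-1}$. The height of $(x,y)$ is $h(x,y)=-t_bx+t_ay$, and $h_{\min}(c)$, $h_{\max}(c)$ are the minimum and maximum of $h(c_i)$ over $0\le i\le m$. Fix a sight $s\ge 1$. For $1\le i\le m-1$ let $w^r(c,i)=w_{i+1}w_{i+2}\cdots w_{\min(i+s,m)}$ and $w^l(c,i)=w_iw_{i-1}\cdots w_{\max(i-s+1,1)}$. Let $g$ be the word morphism exchanging $a$ and $b$. The rule $\delta^r(w,w')\in\{0,1\}$ on nonempty words of length at most $s$ is defined as follows. If $w,w'$ start with the same letter, $\delta^r(w,w')=0$. If $w$ starts with $b$ and $w'$ with $a$, $\delta^r(w,w')=\delta^r(g(w),g(w'))$. If $w$ starts with $a$ and $w'$ with $b$, let $a_j,b_j$ be the numbers of letters $a$ and $b$ in the prefix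 of length $j$ of $w$, and let $(r_a,r_b)$ be the pair (number of $a$, number of $b$) of the shortest nonempty prefix of $w'$ that minimizes the ratio (number of $b$)/(number of $a$), with $y/0=+\infty$; then $\delta^r(w,w')=1$ if and only if $|w'|=s$ and there is $1\le j\le |w|$ such that either $r_ba_j-r_ab_j>r_a+r_b$, or $r_ba_j-r_ab_j=r_a+r_b$ and $\gcd(a_j-1,b_j+1)=1$. Put $\delta(w,w')=\max\{\delta^r(w,w'),\delta^r(w',w)\}$. The site $c_i$ is active if $\delta(w^l(c,i),w^r(c,i))=1$. The random process $(c^t)_{t\ge 0}$ is the Markov chain in which, at each step, an index $i\in\{1,\dots,m-1\}$ is selected uniformly at random; if $c_i$ is active, then $w_i$ and $w_{i+1}$ are exchanged (so that only $c_i$ moves), and otherwise nothing changes. **Theorem.** For all coprime $t_a,t_b\ge1$ there is a constant $C$, depending only on $t_a$ and $t_b$, such that for all $s$ and $n$ with $t_a+t_b\le s$ and $2s\le m+1$ (equivalently, every site $c_i$, $1\le i\le m-1$, has at least $s$ letters of the path on at least one of its two sides), and for any (possibly random) initial configuration $c^0$, the process almost surely reaches a configuration $c$ with $$-(t_a+t_b)+1\le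 h_{\min}(c)<h_{\max}(c)\le t_a+t_b-1,$$ and the first time $T$ at which it is in such a configuration satisfies $\mathbb E[T]\le C\,n^4$. -/

import Mathlib

open MeasureTheory
open scoped ENNReal NNReal

namespace LatticeThread

/-- The two letters: `a` is the unit step `(1, 0)`, `b` is the unit step `(0, 1)`. -/
inductive Letter where
  | a
  | b
  deriving DecidableEq

/-- The morphism exchanging the letters `a` and `b`. -/
def Letter.swap : Letter → Letter
  | .a => .b
  | .b => .a

/-- The word morphism `g` induced by `a ↦ b`, `b ↦ a`. -/
def swapWord (w : List Letter) : List Letter := w.map Letter.swap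

/-- The number of letters `a` in the prefix of length `j` of `w`. -/
def prefA (w : List Letter) (j : ℕ) : ℕ := (w.take j).count Letter.a

/-- The number of letters `b` in the prefix of length `j` of `w`. -/
def prefB (w : List Letter) (j : ℕ) : ℕ := (w.take j).count Letter.b

/-- A configuration: a lattice path from `(0, 0)` to `(A, B)` with unit steps `a` and `b`,
given by its associated word `w₁ w₂ … w_{A+B}`, which has `A` letters `a` and `B` letters `b`. -/
@[ext]
structure Config (A B : ℕ) where
  word : List Letter
  count_a : word.count Letter.a = A
  count_b : word.count Letter.b = B

/-- The set of configurations is finite; it carries the discrete `σ`-algebra. -/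
instance (A B : ℕ) : MeasurableSpace (Config A B) := ⊤

/-- The site `c_i` of the path, for `0 ≤ i ≤ A + B`. -/
def Config.site {A B : ℕ} (c : Config A B) (i : ℕ) : ℕ × ℕ := (prefA c.word i, prefB c.word i)

/-- The height `-t_b x + t_a y` of the site `(x, y)`. -/
def height (ta tb : ℕ) (v : ℕ × ℕ) : ℤ := -(tb : ℤ) * v.1 + (ta : ℤ) * v.2

/-- The maximal height of the sites `c_0, …, c_{A+B}`. -/
def hmax (ta tb : ℕ) {A B : ℕ} (c : Config A B) : ℤ :=
  (Finset.range (A + B + 1)).sup' Finset.nonempty_range_add_one fun i => height ta tb (c.site i)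

/-- The minimal height of the sites `c_0, …, c_{A+B}`. -/
def hmin (ta tb : ℕ) {A B : ℕ} (c : Config A B) : ℤ :=
  (Finset.range (A + B + 1)).inf' Finset.nonempty_range_add_one fun i => height ta tb (c.site i)

/-- Exchange of the letters number `k + 1` and `k + 2` of a word (letters are numbered from `1`). -/
def swapAt : ℕ → List Letter → List Letter
  | 0, x :: y :: l => y :: x :: l
  | k + 1, x :: l => x :: swapAt k l
  | _, l => l

theorem swapAt_perm (k : ℕ) (l : List Letter) : (swapAt k l).Perm l := by
  induction k generalizing l with
  | zero =>
    match l with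
    | [] => exact List.Perm.refl _
    | [_] => exact List.Perm.refl _
    | x :: y :: l => exact List.Perm.swap x y l
  | succ k ih =>
    match l with
    | [] => exact List.Perm.refl _
    | x :: l => exact (ih l).cons x

/-- Flipping in the site `c_i`, `1 ≤ i ≤ A + B - 1`: the letters `w_i` and `w_{i+1}`, which are the
steps into and out of `c_i`, are exchanged. No other site moves. -/
def Config.flip {A B : ℕ} (c : Config A B) (i : ℕ) : Config A B where
  word := swapAt (i - 1) c.word
  count_a := ((swapAt_perm (i - 1) c.word).count_eq Letter.a).trans c.count_a
  count_b := ((swapAt_perm (i - 1) c.word).count_eq Letter.b).trans c.count_b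

/-- The right word `w_{i+1} w_{i+2} … w_{i+s}`, cut at the end of the path. -/
def Config.rightWord {A B : ℕ} (s : ℕ) (c : Config A B) (i : ℕ) : List Letter :=
  (c.word.drop i).take s

/-- The left word `w_i w_{i-1} … w_{i-s+1}`, cut at the beginning of the path. -/
def Config.leftWord {A B : ℕ} (s : ℕ) (c : Config A B) (i : ℕ) : List Letter :=
  ((c.word.take i).reverse).take s

/-- `k` is the least length of a nonempty prefix of `w'` for which the ratio
`(number of b) / (number of a)` is minimal, where `y / 0 = +∞`. As nonempty prefixes have
`(number of a, number of b) ≠ (0, 0)`, the ratios are compared by cross-multiplication. -/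
def IsSteepest (w' : List Letter) (k : ℕ) : Prop :=
  (1 ≤ k ∧ k ≤ w'.length) ∧
  ∀ l, 1 ≤ l → l ≤ w'.length →
    prefB w' k * prefA w' l ≤ prefB w' l * prefA w' k ∧
    (prefB w' k * prefA w' l = prefB w' l * prefA w' k → k ≤ l)

/-- The weak thickness constraint on `(w, w')`, for the pair `(r_a, r_b)`:
`r_b a_j - r_a b_j ≥ r_a + r_b` for some prefix length `j` of `w`. -/
def WeakThickness (ra rb : ℤ) (w : List Letter) : Prop :=
  ∃ j, 1 ≤ j ∧ j ≤ w.length ∧ rb * prefA w j - ra * prefB w j ≥ ra + rb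

/-- The strong thickness constraint: for some prefix length `j` of `w`, either
`r_b a_j - r_a b_j > r_a + r_b`, or there is equality and `a_j - 1`, `b_j + 1` are coprime. -/
def StrongThickness (ra rb : ℤ) (w : List Letter) : Prop :=
  ∃ j, 1 ≤ j ∧ j ≤ w.length ∧
    (rb * prefA w j - ra * prefB w j > ra + rb ∨
      (rb * prefA w j - ra * prefB w j = ra + rb ∧
        Int.gcd ((prefA w j : ℤ) - 1) ((prefB w j : ℤ) + 1) = 1))

/-- The constraints of the right rule on a pair `(w, w')` where `w` starts with `a` and `w'`
starts with `b`: sight constraint, weak and strong thickness constraints. -/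
def Constraints (s : ℕ) (w w' : List Letter) : Prop :=
  w'.length = s ∧
  ∃ k, IsSteepest w' k ∧ WeakThickness (prefA w' k) (prefB w' k) w ∧
    StrongThickness (prefA w' k) (prefB w' k) w

/-- The rule `δ^r`: it never holds if `w` and `w'` start with the same letter, and it is invariant
under the exchange `g` of the two letters. -/
def ruleRight (s : ℕ) (w w' : List Letter) : Prop :=
  (w.head? = some Letter.a ∧ w'.head? = some Letter.b ∧ Constraints s w w') ∨
  (w.head? = some Letter.b ∧ w'.head? = some Letter.a ∧
    Constraints s (swapWord w) (swapWord w'))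

/-- The local transition rule `δ = max (δ^r, δ^l)` of sight `s`, with `δ^l (w, w') = δ^r (w', w)`. -/
def rule (s : ℕ) (w w' : List Letter) : Prop := ruleRight s w w' ∨ ruleRight s w' w

/-- The site `c_i` is active. -/
def Config.Active {A B : ℕ} (s : ℕ) (c : Config A B) (i : ℕ) : Prop :=
  rule s (c.leftWord s i) (c.rightWord s i)

open Classical in
/-- The configuration obtained when the index `i` is selected: the site `c_i` is flipped if it is
active, otherwise nothing is done. -/
noncomputable def Config.update {A B : ℕ} (s : ℕ) (c : Config A B) (i : ℕ) : Config A B :=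
  if c.Active s i then c.flip i else c

open Classical in
/-- The probability that the configuration after `c` is `c'`, when the index `i` is selected
uniformly at random in `{1, …, A + B - 1}`. -/
noncomputable def transProb {A B : ℕ} (s : ℕ) (c c' : Config A B) : ℝ≥0∞ :=
  (((Finset.Icc 1 (A + B - 1)).filter fun i => c.update s i = c').card : ℝ≥0∞) /
    ((A + B - 1 : ℕ) : ℝ≥0∞)

/-- `X 0, X 1, …` is the Markov chain on configurations given by the transition rule, with an
arbitrary (possibly random) initial configuration `X 0`. -/
structure IsProcess {Ω : Type*} [MeasurableSpace Ω] (μ : Measure Ω) {A B : ℕ} (s : ℕ)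
    (X : ℕ → Ω → Config A B) : Prop where
  measurable : ∀ t, Measurable (X t)
  markov : ∀ (t : ℕ) (x : ℕ → Config A B),
    μ {ω | ∀ k ≤ t + 1, X k ω = x k} = μ {ω | ∀ k ≤ t, X k ω = x k} * transProb s (x t) (x (t + 1))

/-- The configurations with
`-(t_a + t_b) + 1 ≤ h_min < h_max ≤ t_a + t_b - 1`. -/
def nearLine (ta tb A B : ℕ) : Set (Config A B) :=
  {c | -((ta : ℤ) + tb) + 1 ≤ hmin ta tb c ∧ hmin ta tb c < hmax ta tb c ∧
    hmax ta tb c ≤ (ta : ℤ) + tb - 1}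

/-- The first time at which the process is in the set `G` (`∞` if this never happens). -/
noncomputable def hitTime {Ω α : Type*} (X : ℕ → Ω → α) (G : Set α) (ω : Ω) : ℝ≥0∞ :=
  ⨅ (t : ℕ) (_ : X t ω ∈ G), (t : ℝ≥0∞)

end LatticeThread

namespace LatticeThread

/-! Put T = ta + tb and m = nT, and let H be the maximal height. Every step changes the height by ta
modulo T, so the sites of height H lie in one residue class modulo T and split into runs of spacing
T.

Read through heights (`Constraints.up`, `Constraints.of_heights`), the rule lets a local minimum
rise by T only if the path already has a site at least T above it. Hence H never increases
(`Config.hmax_update_le`). The gcd condition adds that a flip reaching level H lands at distance T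
from a site of that level, so runs may grow at their ends or merge, but no new run appears.

As long as H ≥ T, let F be the number of sites of height H plus the number of runs. A flip into or
out of a site of that level changes F by the number of its neighbours at distance T missing from the
level. The core is `Profile.card_gains_le`: summed over all indices, the gains of F do not exceed
the losses. Each possible growth is paired with a run end, and a run end fails to be active only
close to an extremity of the path, where `Profile.not_isGain_of_not_act` forbids the corresponding
growth.

F itself may have zero drift. The concave function F(2K - F), with K = 2m ≥ F, turns the balance
into a strict decrease: its second-order term loses at least 1 in the sum over indices, because some
run end is always active (`Profile.exists_act`, which needs 2s ≤ m + 1). Each level of H contributes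
a further K², which pays for the change of F when H drops. Exchanging the letters treats the minimal
height in the same way.

The total potential is O(n³) and decreases in mean by at least 1/(m - 1) outside the target, so the
hitting time has mean O(n⁴) (`hitTime_of_drift`). -/

/-! ### Steepest prefixes, and the constraints in terms of heights -/

theorem count_add_count (l : List Letter) : l.count Letter.a + l.count Letter.b = l.length := by
  induction l with
  | nil => rfl
  | cons x l ih => cases x <;> simp <;> omega

theorem prefA_add_prefB (w : List Letter) {j : ℕ} (hj : j ≤ w.length) :
    prefA w j + prefB w j = j := by
  simp [prefA, prefB, count_add_count, hj]

theorem exists_isSteepest (w : List Letter) (hw : 1 ≤ w.length) : ∃ k, IsSteepest w k := by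
  obtain ⟨k, hk, hmin⟩ := Finset.exists_min_image (Finset.Icc 1 w.length)
    -- The proportion b/(a + b) is ordered as b/a and stays finite when a = 0. The second component
    -- selects the shortest minimizer.
    (fun l => toLex ((prefB w l : ℚ) / l, l)) ⟨1, by simpa using hw⟩
  rw [Finset.mem_Icc] at hk
  refine ⟨k, hk, fun l hl1 hl2 => ?_⟩
  have h := hmin l (Finset.mem_Icc.2 ⟨hl1, hl2⟩)
  have hkpos : (0 : ℚ) < k := by exact_mod_cast hk.1
  have hlpos : (0 : ℚ) < l := by exact_mod_cast hl1
  have hk' : (prefA w k : ℚ) + prefB w k = k := by exact_mod_cast prefA_add_prefB w hk.2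
  have hl' : (prefA w l : ℚ) + prefB w l = l := by exact_mod_cast prefA_add_prefB w hl2
  rw [Prod.Lex.toLex_le_toLex] at h
  have e1 : (prefB w k : ℚ) * prefA w l - prefB w l * prefA w k
      = prefB w k * l - prefB w l * k := by rw [← hk', ← hl']; ring
  rcases h with h | ⟨h, h'⟩
  · rw [div_lt_div_iff₀ hkpos hlpos] at h
    have : (prefB w k * prefA w l : ℚ) < prefB w l * prefA w k := by linarith
    have : prefB w k * prefA w l < prefB w l * prefA w k := by exact_mod_cast this
    exact ⟨this.le, fun h => absurd h this.ne⟩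
  · rw [div_eq_div_iff hkpos.ne' hlpos.ne'] at h
    have : (prefB w k * prefA w l : ℚ) = prefB w l * prefA w k := by linarith
    have : prefB w k * prefA w l = prefB w l * prefA w k := by exact_mod_cast this
    exact ⟨this.le, fun _ => h'⟩

theorem exists_mul_eq_of_mul_eq_mul {ta tb x y : ℤ} (hta : 0 < ta) (hcop : IsCoprime ta tb)
    (h : tb * x = ta * y) : ∃ e, x = ta * e ∧ y = tb * e := by
  obtain ⟨e, rfl⟩ : ta ∣ x := hcop.dvd_of_dvd_mul_left ⟨y, h⟩
  refine ⟨e, rfl, ?_⟩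
  have : ta * y = ta * (tb * e) := by rw [← h]; ring
  exact mul_left_cancel₀ hta.ne' this

/-- Thickness along the direction (ra, rb) passes to the steeper direction (ta, tb), because the
displacement (α - 1, β + 1) has positive first coordinate. -/
theorem height_le_of_slope_le {ta tb ra rb α β : ℤ} (hta : 0 < ta) (hra : 0 < ra) (hrb : 0 ≤ rb)
    (hβ : 0 ≤ β) (hslope : ta * rb ≤ tb * ra) (h : ra * (β + 1) ≤ rb * (α - 1)) :
    0 < α - 1 ∧ ta * (β + 1) ≤ tb * (α - 1) ∧
      (ra * (β + 1) < rb * (α - 1) → ta * (β + 1) < tb * (α - 1)) := by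
  have hα : 0 < α - 1 := by
    by_contra hcon
    have h2 : 0 < ra * (β + 1) := by positivity
    have h3 : rb * (α - 1) ≤ 0 := mul_nonpos_of_nonneg_of_nonpos hrb (by omega)
    omega
  have h1 : ta * rb * (α - 1) ≤ tb * ra * (α - 1) := mul_le_mul_of_nonneg_right hslope hα.le
  refine ⟨hα, le_of_mul_le_mul_left (a := ra) ?_ hra,
    fun h' => lt_of_mul_lt_mul_left (a := ra) ?_ hra.le⟩
  · have := mul_le_mul_of_nonneg_left h hta.le
    linarith
  · have := mul_lt_mul_of_pos_left h' hta
    linarith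

/-- A flip allowed by the rule stays below the sites in sight. -/
theorem Constraints.up {ta tb s : ℕ} {w w' : List Letter} (hta : 0 < ta) (htb : 0 < tb)
    (hcop : Nat.Coprime ta tb) (hc : Constraints s w w') :
    w'.length = s ∧
      ((∀ l, 1 ≤ l → l ≤ s → (tb : ℤ) * prefA w' l < ta * prefB w' l) ∨
        ∃ j, 1 ≤ j ∧ j ≤ w.length ∧
          ((ta : ℤ) + tb < tb * prefA w j - ta * prefB w j ∨
            (j = ta + tb ∧ (tb : ℤ) * prefA w j - ta * prefB w j = ta + tb))) := by
  obtain ⟨hs, k, ⟨⟨hk1, hk2⟩, hst⟩, -, j, hj1, hj2, hj⟩ := hc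
  refine ⟨hs, ?_⟩
  have hk := prefA_add_prefB w' hk2
  have hjj := prefA_add_prefB w hj2
  set ra := prefA w' k
  set rb := prefB w' k
  set α := prefA w j
  set β := prefB w j
  have hta' : (0 : ℤ) < ta := by exact_mod_cast hta
  have htb' : (0 : ℤ) < tb := by exact_mod_cast htb
  have hra0 : (0 : ℤ) ≤ ra := by positivity
  have hrb0 : (0 : ℤ) ≤ rb := by positivity
  have hα0 : (0 : ℤ) ≤ α := by positivity
  have hβ0 : (0 : ℤ) ≤ β := by positivity
  rcases lt_or_ge ((tb : ℤ) * ra) (ta * rb) with hlt | hge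
  · left
    intro l hl1 hl2
    -- Every prefix has ratio at least rb/ra, which exceeds tb/ta here, so all sites in sight on
    -- this side are strictly higher.
    have hle := (hst l hl1 (hs ▸ hl2)).1
    have hl := prefA_add_prefB w' (hs ▸ hl2 : l ≤ w'.length)
    set x := prefA w' l
    set y := prefB w' l
    have hle' : (rb : ℤ) * x ≤ y * ra := by exact_mod_cast hle
    rcases Nat.eq_zero_or_pos x with hx | hx
    · have hy : (0 : ℤ) < y := by omega
      rw [hx]
      simpa using mul_pos hta' hy
    · have hx' : (0 : ℤ) < x := by exact_mod_cast hx
      have hrb : (0 : ℤ) < rb := by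
        by_contra h
        have : (rb : ℤ) = 0 := by omega
        rw [this] at hlt
        nlinarith
      have hra : (0 : ℤ) < ra := by
        by_contra h
        have : (ra : ℤ) = 0 := by omega
        rw [this] at hle'
        nlinarith
      have h1 : (tb : ℤ) * ra * x < ta * rb * x := mul_lt_mul_of_pos_right hlt hx'
      have h2 : (ta : ℤ) * (rb * x) ≤ ta * (y * ra) := mul_le_mul_of_nonneg_left hle' hta'.le
      by_contra hcon
      have h3 : (ra : ℤ) * (ta * y) ≤ ra * (tb * x) :=
        mul_le_mul_of_nonneg_left (not_lt.1 hcon) hra.le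
      nlinarith
  · right
    refine ⟨j, hj1, hj2, ?_⟩
    have hra : (0 : ℤ) < ra := by
      by_contra h
      have h0 : ra = 0 := by omega
      have h1 : (0 : ℤ) < rb := by omega
      rw [h0] at hge
      have := mul_pos hta' h1
      simp at hge
      omega
    have hweak : (ra : ℤ) * (β + 1) ≤ rb * (α - 1) := by
      rcases hj with hj | ⟨hj, -⟩ <;> nlinarith
    obtain ⟨hα, h3, h3'⟩ := height_le_of_slope_le hta' hra hrb0 hβ0 hge hweak
    rcases h3.lt_or_eq with h3 | h3
    · left; linarith
    · right
      -- Equality of heights excludes strict thickness, so the gcd condition holds. The vector (α -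
      -- 1, β + 1) is then a multiple of (ta, tb) with coprime coordinates, hence (ta, tb) itself,
      -- and j = ta + tb.
      have hgcd : Int.gcd ((α : ℤ) - 1) (β + 1) = 1 := by
        rcases hj with hj | ⟨-, hj⟩
        · exfalso
          have h4 : (ra : ℤ) * (β + 1) < rb * (α - 1) := by linarith
          exact (h3' h4).ne h3
        · exact hj
      obtain ⟨e, he1, he2⟩ := exists_mul_eq_of_mul_eq_mul hta'
        (Nat.isCoprime_iff_coprime.2 hcop) h3.symm
      rw [he1, he2, Int.gcd_mul_right] at hgcd
      have he : e.natAbs = 1 := Nat.eq_one_of_mul_eq_one_left hgcd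
      have he0 : 0 < e := pos_of_mul_pos_right (he1 ▸ hα) hta'.le
      have he' : e = 1 := by omega
      rw [he', mul_one] at he1 he2
      refine ⟨by omega, by linarith⟩

/-- A sufficient condition for the constraints, in terms of heights. -/
theorem Constraints.of_heights {ta tb s j : ℕ} {w w' : List Letter} (hta : 0 < ta) (htb : 0 < tb)
    (hcop : Nat.Coprime ta tb) (hs1 : 1 ≤ s) (hs : w'.length = s)
    (hw' : ∀ l, 1 ≤ l → l ≤ s → (tb : ℤ) * prefA w' l ≤ ta * prefB w' l)
    (hj1 : 1 ≤ j) (hj2 : j ≤ w.length)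
    (hj : (ta : ℤ) + tb ≤ tb * prefA w j - ta * prefB w j)
    (hj' : (ta : ℤ) + tb < tb * prefA w j - ta * prefB w j ∨ j ≤ ta + tb) :
    Constraints s w w' := by
  obtain ⟨k, hk⟩ := exists_isSteepest w' (hs ▸ hs1)
  suffices h : StrongThickness (prefA w' k) (prefB w' k) w by
    refine ⟨hs, k, hk, ?_, h⟩
    obtain ⟨i, hi1, hi2, hi⟩ := h
    exact ⟨i, hi1, hi2, hi.elim (fun h => h.le) fun h => h.1.ge⟩
  refine ⟨j, hj1, hj2, ?_⟩
  have hkk := prefA_add_prefB w' hk.1.2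
  have hslope := hw' k hk.1.1 (hs ▸ hk.1.2)
  have hk1 := hk.1.1
  have hjj := prefA_add_prefB w hj2
  set ra := prefA w' k
  set rb := prefB w' k
  set α := prefA w j
  set β := prefB w j
  have hta' : (0 : ℤ) < ta := by exact_mod_cast hta
  have htb' : (0 : ℤ) < tb := by exact_mod_cast htb
  have hra0 : (0 : ℤ) ≤ ra := by positivity
  have hα0 : (0 : ℤ) ≤ α := by positivity
  have hβ0 : (0 : ℤ) ≤ β := by positivity
  have h3 : (ta : ℤ) * (β + 1) ≤ tb * (α - 1) := by linarith
  have hα : (0 : ℤ) < (α : ℤ) - 1 := by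
    by_contra h
    have : (0 : ℤ) < ta * (β + 1) := by positivity
    have : (tb : ℤ) * (α - 1) ≤ 0 := mul_nonpos_of_nonneg_of_nonpos htb'.le (by omega)
    omega
  have h1 : (tb : ℤ) * ra * (α - 1) ≤ ta * rb * (α - 1) := mul_le_mul_of_nonneg_right hslope hα.le
  have h2 : (ra : ℤ) * (ta * (β + 1)) ≤ ra * (tb * (α - 1)) :=
    mul_le_mul_of_nonneg_left h3 hra0
  have h4 : (ra : ℤ) * (β + 1) ≤ rb * (α - 1) := by
    by_contra hcon
    have := mul_lt_mul_of_pos_left (not_le.1 hcon) hta'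
    nlinarith
  rcases h4.lt_or_eq with h4 | h4
  · left; linarith
  · right
    refine ⟨by linarith, ?_⟩
    have hrapos : (0 : ℤ) < ra := by
      by_contra h
      have h0 : (ra : ℤ) = 0 := by omega
      have : (0 : ℤ) < rb := by omega
      rw [h0] at h4
      nlinarith
    have h5 : (ta : ℤ) * (β + 1) = tb * (α - 1) := by
      have h6 : (ta : ℤ) * (ra * (β + 1)) = ta * (rb * (α - 1)) := by rw [h4]
      exact mul_left_cancel₀ hrapos.ne' (le_antisymm h2 (by nlinarith))
    -- In the equality case (α - 1, β + 1) = e (ta, tb) and j = e (ta + tb), so the bound on j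
    -- leaves only e = 1, for which the gcd is 1.
    have hjT : j ≤ ta + tb := hj'.resolve_left (by linarith)
    obtain ⟨e, he1, he2⟩ := exists_mul_eq_of_mul_eq_mul hta'
      (Nat.isCoprime_iff_coprime.2 hcop) h5.symm
    have he0 : 0 < e := by
      by_contra h
      nlinarith
    have he : e ≤ 1 := by
      by_contra h
      have h7 : (j : ℤ) = (ta + tb) * e := by
        rw [add_mul, ← he1, ← he2, ← hjj]; push_cast; ring
      have h8 : (j : ℤ) ≤ ta + tb := by exact_mod_cast hjT
      nlinarith
    have he' : e = 1 := by omega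
    rw [he1, he2, he', mul_one, mul_one]
    exact Int.isCoprime_iff_gcd_eq_one.1 (Nat.isCoprime_iff_coprime.2 hcop)

/-! ### Runs of the top level: gains against losses -/

/-- The heights `h i` of a path at the sites `0 ≤ i ≤ m`, of maximum at most `H`, together with the
set of active sites: the properties from which the evolution of the level `H` is controlled.
The number `T` stands for `t_a + t_b`. -/
structure Profile (t T s m H : ℤ) (h : ℤ → ℤ) (act : ℤ → Prop) : Prop where
  T_pos : 0 < T
  T_le_s : T ≤ s
  sight : 2 * s ≤ m + 1
  coprime : IsCoprime T t
  dvd_m : T ∣ m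
  h_zero : h 0 = 0
  h_end : h m = 0
  dvd_h : ∀ i, 0 ≤ i → i ≤ m → T ∣ h i - t * i
  le_max : ∀ i, 0 ≤ i → i ≤ m → h i ≤ H
  T_le_H : T ≤ H
  act_right : ∀ i j, 0 < i → i < m → h i = H → i + s ≤ m → 1 ≤ j → j ≤ s → j ≤ i →
    h (i - j) ≤ H - T → (h (i - j) < H - T ∨ j ≤ T) → act i
  act_left : ∀ i j, 0 < i → i < m → h i = H → s ≤ i → 1 ≤ j → j ≤ s → i + j ≤ m →
    h (i + j) ≤ H - T → (h (i + j) < H - T ∨ j ≤ T) → act i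

/-- The properties of the sites that may be flipped to the level `H`. -/
structure IsGain (T s m H : ℤ) (h : ℤ → ℤ) (i : ℤ) : Prop where
  pos : 0 < i
  lt : i < m
  height_eq : h i = H - T
  cases : (i + s ≤ m ∧ ((∀ l, 1 ≤ l → l ≤ s → H - T < h (i + l)) ∨ (T ≤ i ∧ h (i - T) = H))) ∨
    (s ≤ i ∧ ((∀ l, 1 ≤ l → l ≤ s → H - T < h (i - l)) ∨ (i + T ≤ m ∧ h (i + T) = H)))

/-- The sites of height `H`. -/
noncomputable def levelSet (m H : ℤ) (h : ℤ → ℤ) : Finset ℤ := (Finset.Ioo 0 m).filter fun i => h i = H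

theorem mem_levelSet {m H : ℤ} {h : ℤ → ℤ} {i : ℤ} :
    i ∈ levelSet m H h ↔ (0 < i ∧ i < m) ∧ h i = H := by
  simp [levelSet]

theorem IsGain.reflect {T s m H : ℤ} {h : ℤ → ℤ} {i : ℤ}
    (hg : IsGain T s m H h i) : IsGain T s m H (fun i => h (m - i)) (m - i) where
  pos := by linarith [hg.lt]
  lt := by linarith [hg.pos]
  height_eq := by simpa using hg.height_eq
  cases := by
    rcases hg.cases with ⟨h1, h2⟩ | ⟨h1, h2⟩
    · right
      refine ⟨by linarith, h2.imp (fun h2 l l1 l2 => ?_) fun h2 => ⟨by linarith [h2.1], ?_⟩⟩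
      · convert h2 l l1 l2 using 2; ring
      · convert h2.2 using 2; ring
    · left
      refine ⟨by linarith, h2.imp (fun h2 l l1 l2 => ?_) fun h2 => ⟨by linarith [h2.1], ?_⟩⟩
      · convert h2 l l1 l2 using 2; ring
      · convert h2.2 using 2; ring

namespace Profile

variable {t T s m H : ℤ} {h : ℤ → ℤ} {act : ℤ → Prop}

/-- Reversing the path exchanges the two one-sided rules. The residue t becomes -t because T divides
m. -/
theorem reflect (P : Profile t T s m H h act) :
    Profile (-t) T s m H (fun i => h (m - i)) (fun i => act (m - i)) where
  T_pos := P.T_pos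
  T_le_s := P.T_le_s
  sight := P.sight
  coprime := P.coprime.neg_right
  dvd_m := P.dvd_m
  h_zero := by simpa using P.h_end
  h_end := by simpa using P.h_zero
  dvd_h i h0 h1 := by
    obtain ⟨e, he⟩ := (P.dvd_h (m - i) (by linarith) (by linarith)).add (P.dvd_m.mul_left t)
    exact ⟨e, by linarith⟩
  le_max i h0 h1 := P.le_max _ (by linarith) (by linarith)
  T_le_H := P.T_le_H
  act_right i j h0 h1 h2 h3 h4 h5 h6 h7 h8 := by
    have e : m - i + j = m - (i - j) := by ring
    exact P.act_left (m - i) j (by linarith) (by linarith) h2 (by linarith) h4 h5 (by linarith)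
      (by rwa [e]) (by rwa [e])
  act_left i j h0 h1 h2 h3 h4 h5 h6 h7 h8 := by
    have e : m - i - j = m - (i + j) := by ring
    exact P.act_right (m - i) j (by linarith) (by linarith) h2 (by linarith) h4 h5 (by linarith)
      (by rwa [e]) (by rwa [e])

theorem mem_reflect {i : ℤ} :
    i ∈ levelSet m H (fun i => h (m - i)) ↔ m - i ∈ levelSet m H h := by
  simp only [mem_levelSet]
  constructor <;> rintro ⟨⟨h1, h2⟩, h3⟩ <;> exact ⟨⟨by linarith, by linarith⟩, h3⟩

theorem dvd_sub_shift (P : Profile t T s m H h act) {i k : ℤ} (hi0 : 0 ≤ i) (hi1 : i ≤ m)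
    (hk0 : 0 ≤ k) (hk1 : k ≤ m) (hik : T ∣ k - i) : T ∣ h k - h i := by
  obtain ⟨e, he⟩ := ((P.dvd_h k hk0 hk1).sub (P.dvd_h i hi0 hi1)).add (hik.mul_left t)
  exact ⟨e, by linarith⟩

/-- Sites at a distance divisible by T have heights congruent modulo T, so H is the only possible
height in (H - T, H]. The extremities are excluded since they have height 0 < H. -/
theorem mem_of_height_gt (P : Profile t T s m H h act) {p k : ℤ} (hp : p ∈ levelSet m H h)
    (hk0 : 0 ≤ k) (hk1 : k ≤ m) (hpk : T ∣ p - k) (hk : H - T < h k) : k ∈ levelSet m H h := by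
  rw [mem_levelSet] at hp ⊢
  have hT := P.T_pos
  have hH := P.T_le_H
  have hmax := P.le_max k hk0 hk1
  have h1 : h k = H := by
    obtain ⟨e, he⟩ := P.dvd_sub_shift hk0 hk1 hp.1.1.le hp.1.2.le hpk
    rw [hp.2] at he
    have : e < 1 := by by_contra hcon; nlinarith
    have : -1 < e := by by_contra hcon; nlinarith
    have : e = 0 := by omega
    rw [this] at he
    linarith
  have h0 := P.h_zero
  have hm := P.h_end
  refine ⟨⟨lt_of_le_of_ne hk0 ?_, lt_of_le_of_ne hk1 ?_⟩, h1⟩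
  · rintro rfl; omega
  · rintro rfl; omega

/-- With full sight on the right, the first site of a run is always active: the site at distance T
before it is low enough to witness thickness, and the origin serves when the path is too short for
that. -/
theorem lt_add_of_not_act (P : Profile t T s m H h act) {p : ℤ} (hp : p ∈ levelSet m H h)
    (hp' : p - T ∉ levelSet m H h) (hact : ¬ act p) : m < p + s := by
  by_contra hcon
  have hp1 := hp
  rw [mem_levelSet] at hp1
  obtain ⟨⟨h0, h1⟩, h2⟩ := hp1
  have hT := P.T_pos
  have hs := P.T_le_s
  have hH := P.T_le_H
  rcases le_or_gt T p with hTp | hTp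
  · refine hact (P.act_right p T h0 h1 h2 (by linarith) (by linarith) hs hTp ?_ (Or.inr le_rfl))
    by_contra hcon
    exact hp' (P.mem_of_height_gt hp (by linarith) (by linarith) (by simp) (by linarith))
  · refine hact (P.act_right p p h0 h1 h2 (by linarith) (by linarith) (by linarith) le_rfl ?_
      (Or.inr hTp.le))
    rw [sub_self, P.h_zero]
    linarith

theorem lt_of_not_act (P : Profile t T s m H h act) {q : ℤ} (hq : q ∈ levelSet m H h)
    (hq' : q + T ∉ levelSet m H h) (hact : ¬ act q) : q < s := by
  have e : m - (m - q) = q := by ring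
  have e' : m - (m - q - T) = q + T := by ring
  have := P.reflect.lt_add_of_not_act (p := m - q) (mem_reflect.2 (by rwa [e]))
    (fun hh => hq' (by rw [mem_reflect, e'] at hh; exact hh)) (by rwa [e])
  linarith

/-- If both the first and the last site of the level were inactive, the first would be less than s
from the end of the path and the last less than s from its beginning, contradicting 2s ≤ m + 1. -/
theorem exists_act (P : Profile t T s m H h act) (hne : (levelSet m H h).Nonempty) :
    ∃ i ∈ levelSet m H h, act i ∧ (i - T ∉ levelSet m H h ∨ i + T ∉ levelSet m H h) := by
  have hT := P.T_pos
  have hs := P.sight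
  by_contra! hcon
  set S := levelSet m H h
  have hp := S.min'_mem hne
  have hq := S.max'_mem hne
  have hp' : S.min' hne - T ∉ S := fun hh => by linarith [S.min'_le _ hh]
  have hq' : S.max' hne + T ∉ S := fun hh => by linarith [S.le_max' _ hh]
  have h1 := P.lt_add_of_not_act hp hp' fun hh => hp' (hcon _ hp hh).1
  have h2 := P.lt_of_not_act hq hq' fun hh => hq' (hcon _ hq hh).2
  linarith [S.min'_le _ hq]

/-- If the first site `p` of a run of the level `H` is not active, then no run that ends after `p`
grows to the right. -/
theorem not_isGain_of_not_act (P : Profile t T s m H h act) {p i : ℤ} (hp : p ∈ levelSet m H h)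
    (hp' : p - T ∉ levelSet m H h) (hact : ¬ act p) (hpi : p ≤ i - T)
    (hi : i + T ∉ levelSet m H h) : ¬ IsGain T s m H h i := by
  intro hg
  have hlt := P.lt_add_of_not_act hp hp' hact
  have hs := P.sight
  have hT := P.T_pos
  have hTs := P.T_le_s
  have hTH := P.T_le_H
  have hgp := hg.pos
  have hgl := hg.lt
  have hp1 := hp
  rw [mem_levelSet] at hp1
  obtain ⟨⟨h0, h1⟩, h2⟩ := hp1
  -- If H > T, the final site of the path, of height 0 < H - T, is in sight of p and witnesses that
  -- p is active by the left rule.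
  have hHT : H = T := by
    by_contra hne
    have e : p + (m - p) = m := by ring
    refine hact (P.act_left p (m - p) h0 h1 h2 (by linarith) (by omega) (by linarith)
      (by linarith) ?_ (Or.inl ?_))
    · rw [e, P.h_end]; linarith
    · rw [e, P.h_end]; omega
  have hdp : T ∣ p := by
    have := P.dvd_h p h0.le h1.le
    rw [h2, hHT, dvd_sub_right dvd_rfl] at this
    exact P.coprime.dvd_of_dvd_mul_left this
  have hdi : T ∣ i := by
    have := P.dvd_h i hgp.le hgl.le
    rw [hg.height_eq, hHT, sub_self, zero_sub, dvd_neg] at this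
    exact P.coprime.dvd_of_dvd_mul_left this
  have him : i + T ≤ m := by
    have := Int.le_of_dvd (by linarith) (P.dvd_m.sub hdi)
    linarith
  rcases hg.cases with ⟨h3, -⟩ | ⟨h3, h4 | ⟨h4, h5⟩⟩
  · linarith
  -- The site p - T is within sight of i, since i + T ≤ m < p + s. It would then lie above H - T,
  -- hence in the level.
  · have := h4 (i - (p - T)) (by linarith) (by linarith)
    have e : i - (i - (p - T)) = p - T := by ring
    rw [e] at this
    exact hp' (P.mem_of_height_gt hp (by linarith) (by linarith) (by simp) this)
  · refine hi (mem_levelSet.2 ⟨⟨by linarith, lt_of_le_of_ne h4 fun hh => ?_⟩, h5⟩)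
    rw [hh, P.h_end] at h5
    linarith

open Classical in
-- A growth to the right at i uses up the right end i - T. All these ends lie before the first
-- inactive left end p, while the left ends from p on are at most as many as the right ends from p
-- on.
theorem card_gain_add_card_inactive (P : Profile t T s m H h act) (G : Finset ℤ)
    (hG : ∀ i ∈ G, IsGain T s m H h i) :
    (G.filter fun i => i - T ∈ levelSet m H h ∧ i + T ∉ levelSet m H h).card +
      ((levelSet m H h).filter fun p => p - T ∉ levelSet m H h ∧ ¬ act p).card ≤
      ((levelSet m H h).filter fun q => q + T ∉ levelSet m H h).card := by
  have hT := P.T_pos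
  have hGS : ∀ i ∈ G, i ∉ levelSet m H h := fun i hi hh => by
    have h1 := (hG i hi).height_eq
    rw [mem_levelSet] at hh
    linarith [hh.2]
  set S := levelSet m H h with hS
  set RG := G.filter fun i => i - T ∈ S ∧ i + T ∉ S with hRG
  set E := S.filter fun p => p - T ∉ S ∧ ¬ act p with hE
  set R := S.filter fun q => q + T ∉ S with hR
  have hsub : RG.image (· - T) ⊆ R := by
    intro q hq
    obtain ⟨i, hi, rfl⟩ := Finset.mem_image.1 hq
    rw [hRG, Finset.mem_filter] at hi
    rw [hR, Finset.mem_filter]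
    refine ⟨hi.2.1, ?_⟩
    rw [sub_add_cancel]
    exact hGS i hi.1
  have hcard : (RG.image (· - T)).card = RG.card :=
    Finset.card_image_of_injective _ (sub_left_injective)
  rcases E.eq_empty_or_nonempty with hE0 | hne
  · rw [hE0, Finset.card_empty, add_zero, ← hcard]
    exact Finset.card_le_card hsub
  · obtain ⟨hp1, hp2, hp3⟩ := Finset.mem_filter.1 (E.min'_mem hne)
    set p := E.min' hne with hp
    have hsub' : RG.image (· - T) ⊆ R.filter fun q => ¬ p ≤ q := by
      intro q hq
      refine Finset.mem_filter.2 ⟨hsub hq, fun hpq => ?_⟩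
      obtain ⟨i, hi, rfl⟩ := Finset.mem_image.1 hq
      rw [hRG, Finset.mem_filter] at hi
      exact P.not_isGain_of_not_act hp1 hp2 hp3 hpq hi.2.2 (hG i hi.1)
    have h1 : E.card ≤ (R.filter fun q => p ≤ q).card := by
      set Sp := S.filter fun i => p ≤ i with hSp
      have hL : E ⊆ Sp.filter fun i => i - T ∉ S := by
        intro i hi
        have := E.min'_le i hi
        rw [hE, Finset.mem_filter] at hi
        exact Finset.mem_filter.2 ⟨Finset.mem_filter.2 ⟨hi.1, this⟩, hi.2.1⟩
      have hRR : R.filter (fun q => p ≤ q) = Sp.filter fun i => ¬ (i + T ∈ S) := by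
        ext i
        simp only [hR, hSp, Finset.mem_filter]
        tauto
      -- Translation by T sends the sites of `Sp` with a successor to sites of `Sp` with a
      -- predecessor. Taking complements bounds left ends by right ends.
      have hinj : (Sp.filter fun i => i + T ∈ S).card ≤ (Sp.filter fun i => ¬ (i - T ∉ S)).card := by
        refine Finset.card_le_card_of_injOn (· + T) (fun i hi => ?_)
          ((add_left_injective T).injOn)
        simp only [hSp, Finset.coe_filter, Set.mem_ofPred_eq, Finset.mem_filter, not_not] at hi ⊢
        exact ⟨⟨hi.2, by linarith⟩, by simpa using hi.1.1⟩
      have e1 := Finset.card_filter_add_card_filter_not (s := Sp) (fun i => i + T ∈ S)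
      have e2 := Finset.card_filter_add_card_filter_not (s := Sp) (fun i => i - T ∉ S)
      have := Finset.card_le_card hL
      rw [hRR]
      omega
    have h2 := Finset.card_le_card hsub'
    have e := Finset.card_filter_add_card_filter_not (s := R) (fun q => p ≤ q)
    omega

/-- Gains of the level `H` are compensated by losses. -/
theorem card_gains_le (P : Profile t T s m H h act) (G : Finset ℤ)
    (hG : ∀ i ∈ G, IsGain T s m H h i) (L : Finset ℤ)
    (hL : ∀ i, i ∈ L ↔ i ∈ levelSet m H h ∧ act i) :
    (G.filter fun i => i - T ∉ levelSet m H h).card +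
      (G.filter fun i => i + T ∉ levelSet m H h).card ≤
      (L.filter fun i => i - T ∉ levelSet m H h).card +
      (L.filter fun i => i + T ∉ levelSet m H h).card := by
  classical
  have hT := P.T_pos
  have hTH := P.T_le_H
  have hTs := P.T_le_s
  -- A gain always touches an existing run: either the rule names a site of the level at distance T,
  -- or all sites in sight are higher, and then T ≤ s puts the one at distance T in the level.
  have hmem : ∀ i ∈ G, i - T ∈ levelSet m H h ∨ i + T ∈ levelSet m H h := by
    intro i hi
    have hg := hG i hi
    have h0 := hg.pos
    have h1 := hg.lt
    have hr : ∀ k, 0 ≤ k → k ≤ m → h k = H → k ∈ levelSet m H h := by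
      intro k hk0 hk1 hk
      have e0 := P.h_zero
      have em := P.h_end
      refine mem_levelSet.2 ⟨⟨lt_of_le_of_ne hk0 ?_, lt_of_le_of_ne hk1 ?_⟩, hk⟩
      · rintro rfl; omega
      · rintro rfl; omega
    have hgt : ∀ k, 0 ≤ k → k ≤ m → T ∣ k - i → H - T < h k → k ∈ levelSet m H h := by
      intro k hk0 hk1 hk hk2
      refine hr k hk0 hk1 (le_antisymm (P.le_max k hk0 hk1) ?_)
      obtain ⟨e, he⟩ := P.dvd_sub_shift h0.le h1.le hk0 hk1 hk
      rw [hg.height_eq] at he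
      have : 0 < e := by by_contra hcon; nlinarith
      nlinarith
    rcases hg.cases with ⟨h3, h4 | ⟨h4, h5⟩⟩ | ⟨h3, h4 | ⟨h4, h5⟩⟩
    · right
      exact hgt _ (by linarith) (by linarith) (by simp) (h4 T (by linarith) hTs)
    · left
      exact hr _ (by linarith) (by linarith) h5
    · left
      exact hgt _ (by linarith) (by linarith) (by simp) (h4 T (by linarith) hTs)
    · right
      exact hr _ (by linarith) (by linarith) h5
  have hX := P.card_gain_add_card_inactive G hG
  have hY : (G.filter fun i => i + T ∈ levelSet m H h ∧ i - T ∉ levelSet m H h).card +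
      ((levelSet m H h).filter fun p => p + T ∉ levelSet m H h ∧ ¬ act p).card ≤
      ((levelSet m H h).filter fun q => q - T ∉ levelSet m H h).card := by
    have hinv : ∀ i : ℤ, m - (m - i) = i := fun i => by ring
    have hinv1 : ∀ i : ℤ, m - (m - i - T) = i + T := fun i => by ring
    have hinv2 : ∀ i : ℤ, m - (m - i + T) = i - T := fun i => by ring
    have hinj : Function.Injective fun i : ℤ => m - i := sub_right_injective
    have := P.reflect.card_gain_add_card_inactive (G.image fun i => m - i) (by
      intro i hi
      obtain ⟨k, hk, rfl⟩ := Finset.mem_image.1 hi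
      exact (hG k hk).reflect)
    have hlev : levelSet m H (fun i => h (m - i)) = (levelSet m H h).image fun i => m - i := by
      ext i
      rw [mem_reflect, Finset.mem_image]
      exact ⟨fun hi => ⟨_, hi, hinv i⟩, by rintro ⟨k, hk, rfl⟩; rwa [hinv]⟩
    simp only [mem_reflect] at this
    rw [hlev] at this
    simpa only [Finset.filter_image, Finset.card_image_of_injective _ hinj, hinv, hinv1, hinv2]
      using this
  set S := levelSet m H h
  have g1 : (G.filter fun i => i - T ∉ S) = G.filter fun i => i + T ∈ S ∧ i - T ∉ S :=
    Finset.filter_congr fun i hi => ⟨fun hh => ⟨(hmem i hi).resolve_left hh, hh⟩, fun hh => hh.2⟩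
  have g2 : (G.filter fun i => i + T ∉ S) = G.filter fun i => i - T ∈ S ∧ i + T ∉ S :=
    Finset.filter_congr fun i hi => ⟨fun hh => ⟨(hmem i hi).resolve_right hh, hh⟩, fun hh => hh.2⟩
  have hLS : L = S.filter act := by ext i; rw [hL, Finset.mem_filter]
  have key : ∀ (q : ℤ → Prop) [DecidablePred q], (S.filter q).card =
      (L.filter q).card + (S.filter fun p => q p ∧ ¬ act p).card := by
    intro q _
    rw [hLS, ← Finset.card_filter_add_card_filter_not (s := S.filter q) act,
      Finset.filter_filter, Finset.filter_filter, Finset.filter_filter]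
    simp only [and_comm]
  -- Each kind of run end splits into active and inactive ones. Adding `hX` and `hY` cancels the
  -- inactive ends and leaves gains against active ends.
  have k1 := key fun i => i - T ∉ S
  have k2 := key fun i => i + T ∉ S
  rw [g1, g2]
  omega

end Profile

/-! ### The weight of the top level and its drift -/

/-- The number of sites at distance `0` or `T` after an element of `S`. -/
noncomputable def runWeight (T : ℤ) (S : Finset ℤ) : ℕ := (S ∪ S.image (· + T)).card

theorem runWeight_le (T : ℤ) (S : Finset ℤ) : runWeight T S ≤ 2 * S.card := by
  have h1 := Finset.card_union_le S (S.image (· + T))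
  have h2 := Finset.card_image_le (s := S) (f := (· + T))
  unfold runWeight
  omega

/-- The weight is the number of elements plus the number of runs of step T: extending a run adds 1,
a new isolated run adds 2, and joining two runs adds 0. -/
theorem runWeight_insert {T : ℤ} (hT : 0 < T) {S : Finset ℤ} {i : ℤ} (hi : i ∉ S) :
    (runWeight T (insert i S) : ℤ) =
      runWeight T S + ((if i - T ∉ S then 1 else 0) + (if i + T ∉ S then 1 else 0)) := by
  have e : insert i S ∪ (insert i S).image (· + T) =
      insert i (insert (i + T) (S ∪ S.image (· + T))) := by
    ext k
    simp only [Finset.mem_union, Finset.mem_insert, Finset.mem_image, exists_eq_or_imp]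
    grind
  have h1 : i + T ∈ S ∪ S.image (· + T) ↔ i + T ∈ S := by simp [hi]
  have h2 : i ∈ insert (i + T) (S ∪ S.image (· + T)) ↔ i - T ∈ S := by
    simp only [Finset.mem_union, Finset.mem_insert, Finset.mem_image, hi, false_or]
    constructor
    · rintro (h | ⟨k, hk, rfl⟩)
      · omega
      · simpa using hk
    · exact fun h => Or.inr ⟨_, h, by ring⟩
  unfold runWeight
  rw [e, Finset.card_insert_eq_ite, Finset.card_insert_eq_ite]
  simp only [h1, h2]
  split_ifs <;> push_cast <;> ring

theorem runWeight_erase {T : ℤ} (hT : 0 < T) {S : Finset ℤ} {i : ℤ} (hi : i ∈ S) :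
    (runWeight T (S.erase i) : ℤ) =
      runWeight T S - ((if i - T ∉ S then 1 else 0) + (if i + T ∉ S then 1 else 0)) := by
  have h := runWeight_insert hT (Finset.notMem_erase i S)
  rw [Finset.insert_erase hi] at h
  have h1 : i - T ∈ S.erase i ↔ i - T ∈ S := by
    simp only [Finset.mem_erase, and_iff_right_iff_imp]; intros; omega
  have h2 : i + T ∈ S.erase i ↔ i + T ∈ S := by
    simp only [Finset.mem_erase, and_iff_right_iff_imp]; intros; omega
  simp only [h1, h2] at h
  linarith

open Classical in
/-- The concave function `x (2 K - x)` of the weight of the highest level decreases in mean. -/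
theorem Profile.drift {t T s m H : ℤ} {h : ℤ → ℤ} {act : ℤ → Prop}
    (P : Profile t T s m H h act) (hne : (levelSet m H h).Nonempty) (G : Finset ℤ)
    (hG : ∀ i ∈ G, IsGain T s m H h i) (S' : ℤ → Finset ℤ)
    (hL : ∀ i ∈ levelSet m H h, act i → S' i = (levelSet m H h).erase i)
    (hI : ∀ i ∈ G, S' i = insert i (levelSet m H h))
    (hO : ∀ i ∈ Finset.Ioo 0 m, ¬ (i ∈ levelSet m H h ∧ act i) → i ∉ G → S' i = levelSet m H h)
    {K : ℤ} (hK : (runWeight T (levelSet m H h) : ℤ) ≤ K) :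
    ∑ i ∈ Finset.Ioo 0 m, (runWeight T (S' i) : ℤ) * (2 * K - runWeight T (S' i)) + 1 ≤
      ∑ _i ∈ Finset.Ioo 0 m,
        (runWeight T (levelSet m H h) : ℤ) * (2 * K - runWeight T (levelSet m H h)) := by
  have hT := P.T_pos
  have hGS : ∀ i ∈ G, i ∉ levelSet m H h := fun i hi hh => by
    have h1 := (hG i hi).height_eq
    rw [mem_levelSet] at hh
    linarith [hh.2]
  have hact := P.exists_act hne
  have hgl := P.card_gains_le G hG ((levelSet m H h).filter act) fun i => Finset.mem_filter
  have hSm : levelSet m H h ⊆ Finset.Ioo 0 m := Finset.filter_subset _ _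
  have hGm : G ⊆ Finset.Ioo 0 m := fun i hi => Finset.mem_Ioo.2 ⟨(hG i hi).pos, (hG i hi).lt⟩
  set S := levelSet m H h
  set L := S.filter act with hLdef
  set F : ℤ := ((runWeight T S : ℕ) : ℤ)
  let d : ℤ → ℤ := fun i => (if i - T ∉ S then 1 else 0) + (if i + T ∉ S then 1 else 0)
  have hd0 : ∀ i, 0 ≤ d i := fun i => by
    simp only [d]; split_ifs <;> norm_num
  have hsum : ∀ A : Finset ℤ, ∑ i ∈ A, d i =
      (A.filter fun i => i - T ∉ S).card + (A.filter fun i => i + T ∉ S).card := by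
    intro A
    simp only [d, Finset.sum_add_distrib, Finset.sum_boole]
  have hdG : ∑ i ∈ G, d i ≤ ∑ i ∈ L, d i := by
    rw [hsum, hsum]
    exact_mod_cast hgl
  have hd1 : 1 ≤ ∑ i ∈ L, d i * d i := by
    obtain ⟨i, hi, hia, hi'⟩ := hact
    have h1 : 1 ≤ d i := by
      rcases hi' with hi' | hi' <;> simp only [d, if_pos hi'] <;> split_ifs <;> norm_num
    have h2 := Finset.single_le_sum (f := fun i => d i * d i) (fun j _ => mul_self_nonneg (d j))
      (Finset.mem_filter.2 ⟨hi, hia⟩ : i ∈ L)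
    have h3 : 1 * 1 ≤ d i * d i := mul_le_mul h1 h1 zero_le_one (hd0 i)
    linarith
  -- Expansion of x(2K - x) at F ± d. The square d² is kept for losses, where it yields the strict
  -- decrease, and dropped for gains.
  have hpt : ∀ i ∈ Finset.Ioo 0 m, (runWeight T (S' i) : ℤ) * (2 * K - runWeight T (S' i)) ≤
      F * (2 * K - F) + ((if i ∈ G then 2 * (K - F) * d i else 0) -
        (if i ∈ L then 2 * (K - F) * d i + d i * d i else 0)) := by
    intro i hi
    by_cases h1 : i ∈ L
    · obtain ⟨h2, h3⟩ := Finset.mem_filter.1 h1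
      rw [if_pos h1, if_neg fun hh => hGS i hh h2, hL i h2 h3, runWeight_erase hT h2]
      simp only [d, F]
      apply le_of_eq
      ring
    · rw [if_neg h1]
      by_cases h2 : i ∈ G
      · rw [if_pos h2, hI i h2, runWeight_insert hT (hGS i h2)]
        have h3 := mul_self_nonneg (d i)
        simp only [d, F] at h3 ⊢
        linarith
      · rw [if_neg h2, hO i hi (fun hh => h1 (Finset.mem_filter.2 hh)) h2]
        simp [F]
  have hle := Finset.sum_le_sum hpt
  rw [Finset.sum_add_distrib, Finset.sum_sub_distrib, Finset.sum_ite_mem, Finset.sum_ite_mem,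
    Finset.inter_eq_right.2 hGm, Finset.inter_eq_right.2 ((Finset.filter_subset _ _).trans hSm)]
    at hle
  have h6 : ∑ i ∈ L, (2 * (K - F) * d i + d i * d i) =
      2 * (K - F) * ∑ i ∈ L, d i + ∑ i ∈ L, d i * d i := by
    rw [Finset.sum_add_distrib, Finset.mul_sum]
  have h7 : ∑ i ∈ G, 2 * (K - F) * d i = 2 * (K - F) * ∑ i ∈ G, d i := by rw [Finset.mul_sum]
  rw [h6, h7] at hle
  have h5 : 2 * (K - F) * ∑ i ∈ G, d i ≤ 2 * (K - F) * ∑ i ∈ L, d i :=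
    mul_le_mul_of_nonneg_left hdG (by linarith)
  linarith

/-! ### Words and heights -/

theorem count_take_swapAt (x : Letter) (j k : ℕ) (l : List Letter) (hk : k ≠ j + 1) :
    ((swapAt j l).take k).count x = (l.take k).count x := by
  induction j generalizing l k with
  | zero =>
    match l, k with
    | [], _ => rfl
    | [_], _ => rfl
    | _ :: _ :: _, 0 => rfl
    | _ :: _ :: _, 1 => exact absurd rfl hk
    | _ :: _ :: _, k + 2 => simp only [swapAt, List.take_succ_cons, List.count_cons]; omega
  | succ j ih =>
    match l, k with
    | [], _ => rfl
    | _ :: _, 0 => rfl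
    | y :: l, k + 1 =>
      simp only [swapAt, List.take_succ_cons, List.count_cons, ih k l (by omega)]

theorem count_take_swapAt_self (x : Letter) (j : ℕ) (l : List Letter) (hj : j + 2 ≤ l.length) :
    ((swapAt j l).take (j + 1)).count x + (l.take (j + 1)).count x =
      (l.take j).count x + (l.take (j + 2)).count x := by
  induction j generalizing l with
  | zero =>
    match l, hj with
    | y :: z :: l, _ => simp only [swapAt, List.take_succ_cons, List.take_zero, List.count_cons, List.count_nil]; omega
  | succ j ih =>
    match l, hj with
    | y :: l, hj =>
      have := ih l (by simpa using hj)
      simp only [swapAt, List.take_succ_cons, List.count_cons]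
      omega

theorem head?_eq_a_iff (w : List Letter) :
    w.head? = some Letter.a ↔ prefA w 1 = 1 ∧ prefB w 1 = 0 := by
  match w with
  | [] => simp [prefA]
  | .a :: w => simp [prefA, prefB]
  | .b :: w => simp [prefA, prefB]

theorem head?_eq_b_iff (w : List Letter) :
    w.head? = some Letter.b ↔ prefA w 1 = 0 ∧ prefB w 1 = 1 := by
  match w with
  | [] => simp [prefB]
  | .a :: w => simp [prefA, prefB]
  | .b :: w => simp [prefA, prefB]

theorem length_swapWord (w : List Letter) : (swapWord w).length = w.length := List.length_map _

theorem count_swapWord (w : List Letter) :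
    (swapWord w).count Letter.a = w.count Letter.b ∧
      (swapWord w).count Letter.b = w.count Letter.a := by
  induction w with
  | nil => exact ⟨rfl, rfl⟩
  | cons x w ih =>
    rw [swapWord] at ih
    cases x <;> simp [swapWord, Letter.swap, ih.1, ih.2]

theorem take_swapWord (w : List Letter) (j : ℕ) : (swapWord w).take j = swapWord (w.take j) :=
  List.map_take.symm

theorem prefA_swapWord (w : List Letter) (j : ℕ) : prefA (swapWord w) j = prefB w j := by
  rw [prefA, take_swapWord, (count_swapWord _).1, prefB]

theorem prefB_swapWord (w : List Letter) (j : ℕ) : prefB (swapWord w) j = prefA w j := by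
  rw [prefB, take_swapWord, (count_swapWord _).2, prefA]

theorem swapWord_swapWord (w : List Letter) : swapWord (swapWord w) = w := by
  simp only [swapWord, List.map_map]
  convert List.map_id w using 2
  ext x
  cases x <;> rfl

theorem head?_swapWord (w : List Letter) :
    ((swapWord w).head? = some Letter.a ↔ w.head? = some Letter.b) ∧
      ((swapWord w).head? = some Letter.b ↔ w.head? = some Letter.a) := by
  match w with
  | [] => simp [swapWord]
  | .a :: w => simp [swapWord, Letter.swap]
  | .b :: w => simp [swapWord, Letter.swap]

theorem ruleRight_swapWord (s : ℕ) (w w' : List Letter) :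
    ruleRight s (swapWord w) (swapWord w') ↔ ruleRight s w w' := by
  rw [ruleRight, ruleRight, swapWord_swapWord, swapWord_swapWord, (head?_swapWord w).1,
    (head?_swapWord w).2, (head?_swapWord w').1, (head?_swapWord w').2, or_comm]

theorem rule_swapWord (s : ℕ) (w w' : List Letter) :
    rule s (swapWord w) (swapWord w') ↔ rule s w w' := by
  rw [rule, rule, ruleRight_swapWord, ruleRight_swapWord]

namespace Config

variable {A B : ℕ}

theorem length_word (c : Config A B) : c.word.length = A + B := by
  rw [← count_add_count, c.count_a, c.count_b]

theorem length_rightWord (s : ℕ) (c : Config A B) (i : ℕ) :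
    (c.rightWord s i).length = min s (A + B - i) := by
  simp [rightWord, length_word]

theorem length_leftWord (s : ℕ) (c : Config A B) {i : ℕ} (hi : i ≤ A + B) :
    (c.leftWord s i).length = min s i := by
  simp [leftWord, length_word, hi]

theorem count_take_rightWord (x : Letter) {s j : ℕ} (c : Config A B) (i : ℕ) (hj : j ≤ s) :
    ((c.rightWord s i).take j).count x + (c.word.take i).count x =
      (c.word.take (i + j)).count x := by
  rw [rightWord, List.take_take, min_eq_left hj, List.take_add, List.count_append, add_comm]

theorem count_take_leftWord (x : Letter) {s i j : ℕ} (c : Config A B) (hi : i ≤ A + B)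
    (hj : j ≤ s) :
    ((c.leftWord s i).take j).count x + (c.word.take (i - j)).count x =
      (c.word.take i).count x := by
  have hlen : (c.word.take i).length = i := by simp [length_word, hi]
  rw [leftWord, List.take_take, min_eq_left hj, List.take_reverse, List.count_reverse, hlen]
  conv_rhs => rw [← List.take_append_drop (i - j) (c.word.take i), List.count_append]
  rw [List.take_take, min_eq_left (Nat.sub_le i j), add_comm]

/-- The height of the site `c_z`, extended by constants outside of the path. -/
def ht (ta tb : ℕ) (c : Config A B) (z : ℤ) : ℤ := height ta tb (c.site z.toNat)

theorem ht_natCast (ta tb : ℕ) (c : Config A B) (i : ℕ) :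
    c.ht ta tb i = height ta tb (c.site i) := rfl

theorem ht_rightWord (ta tb : ℕ) {s j : ℕ} (c : Config A B) (i : ℕ) (hj : j ≤ s) :
    c.ht ta tb ((i : ℤ) + j) =
      c.ht ta tb i + (ta * prefB (c.rightWord s i) j - tb * prefA (c.rightWord s i) j) := by
  have h1 := count_take_rightWord Letter.a c i hj
  have h2 := count_take_rightWord Letter.b c i hj
  rw [← Nat.cast_add, ht_natCast, ht_natCast]
  simp only [height, site, prefA, prefB] at *
  rw [← h1, ← h2]
  push_cast
  ring

theorem ht_leftWord (ta tb : ℕ) {s i j : ℕ} (c : Config A B) (hi : i ≤ A + B)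
    (hj : j ≤ s) (hji : j ≤ i) :
    c.ht ta tb ((i : ℤ) - j) =
      c.ht ta tb i - (ta * prefB (c.leftWord s i) j - tb * prefA (c.leftWord s i) j) := by
  have h1 := count_take_leftWord Letter.a c hi hj
  have h2 := count_take_leftWord Letter.b c hi hj
  rw [← Nat.cast_sub hji, ht_natCast, ht_natCast]
  simp only [height, site, prefA, prefB] at *
  rw [← h1, ← h2]
  push_cast
  ring

theorem ht_flip_of_ne (ta tb : ℕ) (c : Config A B) {i : ℕ} (hi : 1 ≤ i) {z : ℤ} (hz : z ≠ i) :
    (c.flip i).ht ta tb z = c.ht ta tb z := by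
  have h : z.toNat ≠ i - 1 + 1 := by omega
  simp only [ht, height, site, prefA, prefB, flip, count_take_swapAt _ _ _ _ h]

theorem ht_flip_self (ta tb : ℕ) (c : Config A B) {i : ℕ} (hi : 1 ≤ i) (hi' : i < A + B) :
    (c.flip i).ht ta tb i = c.ht ta tb ((i : ℤ) - 1) + c.ht ta tb ((i : ℤ) + 1) - c.ht ta tb i := by
  obtain ⟨k, rfl⟩ : ∃ k, i = k + 1 := ⟨i - 1, by omega⟩
  have hlen : k + 2 ≤ c.word.length := by rw [length_word]; omega
  have h1 := count_take_swapAt_self Letter.a k c.word hlen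
  have h2 := count_take_swapAt_self Letter.b k c.word hlen
  have e1 : ((k + 1 : ℕ) : ℤ) - 1 = (k : ℕ) := by push_cast; ring
  have e2 : ((k + 1 : ℕ) : ℤ) + 1 = (k + 2 : ℕ) := by push_cast; ring
  rw [e1, e2]
  simp only [ht_natCast, height, site, prefA, prefB, flip, Nat.add_sub_cancel]
  zify at h1 h2
  linear_combination (-(tb : ℤ)) * h1 + (ta : ℤ) * h2

end Config

/-! ### Active sites and the maximal height -/

namespace Config

variable {A B : ℕ} {ta tb s : ℕ}

/-- An active site is either a local minimum, and then a site that has at least its height after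
the flip is in sight, or a local maximum. -/
theorem Active.cases (hta : 0 < ta) (htb : 0 < tb) (hcop : Nat.Coprime ta tb) (hs : 1 ≤ s)
    {c : Config A B} {i : ℕ} (hi0 : 0 < i) (hi1 : i < A + B) (hact : c.Active s i) :
    (c.ht ta tb ((i : ℤ) - 1) = c.ht ta tb i + tb ∧ c.ht ta tb ((i : ℤ) + 1) = c.ht ta tb i + ta ∧
      (((i : ℤ) + s ≤ A + B ∧
          ((∀ l : ℤ, 1 ≤ l → l ≤ s → c.ht ta tb i < c.ht ta tb (i + l)) ∨
            ∃ j : ℤ, 1 ≤ j ∧ j ≤ i ∧ (c.ht ta tb i + (ta + tb) < c.ht ta tb (i - j) ∨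
              (j = ta + tb ∧ c.ht ta tb (i - j) = c.ht ta tb i + (ta + tb))))) ∨
        ((s : ℤ) ≤ i ∧
          ((∀ l : ℤ, 1 ≤ l → l ≤ s → c.ht ta tb i < c.ht ta tb (i - l)) ∨
            ∃ j : ℤ, 1 ≤ j ∧ (i : ℤ) + j ≤ A + B ∧
              (c.ht ta tb i + (ta + tb) < c.ht ta tb (i + j) ∨
                (j = ta + tb ∧ c.ht ta tb (i + j) = c.ht ta tb i + (ta + tb))))))) ∨
    (c.ht ta tb ((i : ℤ) - 1) = c.ht ta tb i - ta ∧
      c.ht ta tb ((i : ℤ) + 1) = c.ht ta tb i - tb) := by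
  have hR := fun (j : ℕ) (hj : j ≤ s) => c.ht_rightWord ta tb i hj
  have hL := fun (j : ℕ) (hj : j ≤ s) => c.ht_leftWord (s := s) (j := j) ta tb hi1.le hj
  have hRl := c.length_rightWord s i
  have hLl := c.length_leftWord s hi1.le
  have hR1 := hR 1 hs
  have hL1 := hL 1 hs hi0
  rw [Nat.cast_one] at hR1 hL1
  rcases hact with ⟨⟨h1, h2, h3⟩ | ⟨h1, h2, -⟩⟩ | ⟨⟨h1, h2, -⟩ | ⟨h1, h2, h3⟩⟩
  · rw [head?_eq_a_iff] at h1
    rw [head?_eq_b_iff] at h2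
    rw [h2.1, h2.2] at hR1
    rw [h1.1, h1.2] at hL1
    refine Or.inl ⟨by rw [hL1]; push_cast; ring, by rw [hR1]; push_cast; ring, Or.inl ?_⟩
    obtain ⟨h4, h5⟩ := h3.up hta htb hcop
    refine ⟨by omega, h5.imp (fun h5 l hl1 hl2 => ?_) ?_⟩
    · lift l to ℕ using by linarith
      have := h5 l (by omega) (by omega)
      rw [hR l (by omega)]
      linarith
    · rintro ⟨j, hj1, hj2, hj⟩
      refine ⟨j, by omega, by omega, ?_⟩
      rw [hL j (by omega) (by omega)]
      rcases hj with hj | ⟨hj, hj'⟩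
      · left; linarith
      · right; exact ⟨by exact_mod_cast hj, by linarith⟩
  · rw [head?_eq_b_iff] at h1
    rw [head?_eq_a_iff] at h2
    rw [h2.1, h2.2] at hR1
    rw [h1.1, h1.2] at hL1
    exact Or.inr ⟨by rw [hL1]; push_cast; ring, by rw [hR1]; push_cast; ring⟩
  · rw [head?_eq_a_iff] at h1
    rw [head?_eq_b_iff] at h2
    rw [h1.1, h1.2] at hR1
    rw [h2.1, h2.2] at hL1
    exact Or.inr ⟨by rw [hL1]; push_cast; ring, by rw [hR1]; push_cast; ring⟩
  · rw [head?_eq_b_iff] at h1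
    rw [head?_eq_a_iff] at h2
    rw [h1.1, h1.2] at hR1
    rw [h2.1, h2.2] at hL1
    refine Or.inl ⟨by rw [hL1]; push_cast; ring, by rw [hR1]; push_cast; ring, Or.inr ?_⟩
    obtain ⟨h4, h5⟩ := h3.up htb hta hcop.symm
    simp only [prefA_swapWord, prefB_swapWord, length_swapWord] at h4 h5
    refine ⟨by omega, h5.imp (fun h5 l hl1 hl2 => ?_) ?_⟩
    · lift l to ℕ using by linarith
      have := h5 l (by omega) (by omega)
      rw [hL l (by omega) (by omega)]
      linarith
    · rintro ⟨j, hj1, hj2, hj⟩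
      refine ⟨j, by omega, by omega, ?_⟩
      rw [hR j (by omega)]
      rcases hj with hj | ⟨hj, hj'⟩
      · left; linarith
      · right; exact ⟨by omega, by linarith⟩

theorem head?_of_local_max (hta : 0 < ta) (htb : 0 < tb) (hs : 1 ≤ s) {c : Config A B} {i : ℕ}
    (hi0 : 0 < i) (hi1 : i < A + B) (hl : c.ht ta tb ((i : ℤ) - 1) ≤ c.ht ta tb i)
    (hr : c.ht ta tb ((i : ℤ) + 1) ≤ c.ht ta tb i) :
    (c.leftWord s i).head? = some Letter.b ∧ (c.rightWord s i).head? = some Letter.a := by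
  have hR1 := c.ht_rightWord ta tb i hs
  have hL1 := c.ht_leftWord (s := s) (j := 1) ta tb hi1.le hs hi0
  rw [Nat.cast_one] at hR1 hL1
  have hRl := c.length_rightWord s i
  have hLl := c.length_leftWord s hi1.le
  have hRs := prefA_add_prefB (c.rightWord s i) (j := 1) (by omega)
  have hLs := prefA_add_prefB (c.leftWord s i) (j := 1) (by omega)
  rw [head?_eq_a_iff, head?_eq_b_iff]
  constructor
  · by_contra hcon
    have h1 : prefA (c.leftWord s i) 1 = 1 := by omega
    have h2 : prefB (c.leftWord s i) 1 = 0 := by omega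
    rw [h1, h2] at hL1
    push_cast at hL1
    omega
  · by_contra hcon
    have h1 : prefA (c.rightWord s i) 1 = 0 := by omega
    have h2 : prefB (c.rightWord s i) 1 = 1 := by omega
    rw [h1, h2] at hR1
    push_cast at hR1
    omega

/-- The constraints are checked on the exchanged words, hence with ta and tb exchanged: the sites in
sight on the right bound the steepest slope, and the site at distance j on the left witnesses
thickness. -/
theorem active_of_right (hta : 0 < ta) (htb : 0 < tb) (hcop : Nat.Coprime ta tb) (hs : 1 ≤ s)
    {c : Config A B} {i j : ℕ} (hi0 : 0 < i) (hi1 : i < A + B) (his : i + s ≤ A + B)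
    (hl : c.ht ta tb ((i : ℤ) - 1) ≤ c.ht ta tb i)
    (hr : ∀ l : ℕ, 1 ≤ l → l ≤ s → c.ht ta tb ((i : ℤ) + l) ≤ c.ht ta tb i)
    (hj1 : 1 ≤ j) (hj2 : j ≤ s) (hji : j ≤ i)
    (hj : c.ht ta tb ((i : ℤ) - j) ≤ c.ht ta tb i - (ta + tb))
    (hj' : c.ht ta tb ((i : ℤ) - j) < c.ht ta tb i - (ta + tb) ∨ j ≤ ta + tb) :
    c.Active s i := by
  obtain ⟨h1, h2⟩ := head?_of_local_max hta htb hs hi0 hi1 hl (by simpa using hr 1 le_rfl hs)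
  have hRl := c.length_rightWord s i
  have hLl := c.length_leftWord s hi1.le
  refine Or.inl (Or.inr ⟨h1, h2, ?_⟩)
  rw [c.ht_leftWord ta tb hi1.le hj2 hji] at hj hj'
  refine Constraints.of_heights htb hta hcop.symm hs (j := j) ?_ (fun l hl1 hl2 => ?_) hj1 ?_ ?_ ?_
  · rw [length_swapWord]; omega
  · rw [prefA_swapWord, prefB_swapWord]
    have := hr l hl1 hl2
    rw [c.ht_rightWord ta tb i hl2] at this
    linarith
  · rw [length_swapWord]; omega
  · rw [prefA_swapWord, prefB_swapWord]; linarith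
  · rw [prefA_swapWord, prefB_swapWord]
    exact hj'.imp (fun h => by linarith) fun h => by omega

theorem active_of_left (hta : 0 < ta) (htb : 0 < tb) (hcop : Nat.Coprime ta tb) (hs : 1 ≤ s)
    {c : Config A B} {i j : ℕ} (hi0 : 0 < i) (hi1 : i < A + B) (his : s ≤ i)
    (hl : ∀ l : ℕ, 1 ≤ l → l ≤ s → c.ht ta tb ((i : ℤ) - l) ≤ c.ht ta tb i)
    (hr : c.ht ta tb ((i : ℤ) + 1) ≤ c.ht ta tb i)
    (hj1 : 1 ≤ j) (hj2 : j ≤ s) (hji : i + j ≤ A + B)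
    (hj : c.ht ta tb ((i : ℤ) + j) ≤ c.ht ta tb i - (ta + tb))
    (hj' : c.ht ta tb ((i : ℤ) + j) < c.ht ta tb i - (ta + tb) ∨ j ≤ ta + tb) :
    c.Active s i := by
  obtain ⟨h1, h2⟩ := head?_of_local_max hta htb hs hi0 hi1 (by simpa using hl 1 le_rfl hs) hr
  have hRl := c.length_rightWord s i
  have hLl := c.length_leftWord s hi1.le
  refine Or.inr (Or.inl ⟨h2, h1, ?_⟩)
  rw [c.ht_rightWord ta tb i hj2] at hj hj'
  refine Constraints.of_heights hta htb hcop hs (j := j) ?_ (fun l hl1 hl2 => ?_) hj1 ?_ ?_ ?_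
  · omega
  · have := hl l hl1 hl2
    rw [c.ht_leftWord ta tb hi1.le hl2 (by omega)] at this
    linarith
  · omega
  · linarith
  · exact hj'.imp (fun h => by linarith) id

theorem ht_zero (c : Config A B) : c.ht ta tb 0 = 0 := by
  simp [ht, height, site, prefA, prefB]

theorem ht_end (c : Config A B) : c.ht ta tb (A + B : ℕ) = -(tb : ℤ) * A + ta * B := by
  rw [ht_natCast, site, prefA, prefB, List.take_of_length_le c.length_word.le, c.count_a, c.count_b,
    height]

theorem dvd_ht_sub (c : Config A B) {i : ℤ} (h0 : 0 ≤ i) (h1 : i ≤ (A + B : ℕ)) :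
    ((ta : ℤ) + tb) ∣ c.ht ta tb i - ta * i := by
  lift i to ℕ using h0
  have h := prefA_add_prefB c.word (j := i) (by rw [length_word]; omega)
  refine ⟨-prefA c.word i, ?_⟩
  have h' : (prefA c.word i : ℤ) + prefB c.word i = i := by exact_mod_cast h
  rw [ht_natCast, height, site]
  linear_combination (ta : ℤ) * h'

theorem ht_le_hmax (c : Config A B) {i : ℤ} (h0 : 0 ≤ i) (h1 : i ≤ (A + B : ℕ)) :
    c.ht ta tb i ≤ hmax ta tb c := by
  lift i to ℕ using h0
  exact Finset.le_sup' (fun i => height ta tb (c.site i)) (Finset.mem_range.2 (by omega))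

theorem exists_ht_eq_hmax (c : Config A B) :
    ∃ i : ℤ, 0 ≤ i ∧ i ≤ (A + B : ℕ) ∧ c.ht ta tb i = hmax ta tb c := by
  obtain ⟨i, hi, h⟩ := Finset.exists_mem_eq_sup' (Finset.nonempty_range_add_one (n := A + B))
    (fun i => height ta tb (c.site i))
  rw [Finset.mem_range] at hi
  exact ⟨i, by omega, by omega, h.symm⟩

theorem hmax_le_iff (c : Config A B) (z : ℤ) :
    hmax ta tb c ≤ z ↔ ∀ i : ℤ, 0 ≤ i → i ≤ (A + B : ℕ) → c.ht ta tb i ≤ z := by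
  refine ⟨fun h i h0 h1 => (c.ht_le_hmax h0 h1).trans h, fun h => ?_⟩
  obtain ⟨i, h0, h1, h2⟩ := c.exists_ht_eq_hmax (ta := ta) (tb := tb)
  exact h2 ▸ h i h0 h1

/-- The maximal height never increases. -/
theorem hmax_update_le (hta : 0 < ta) (htb : 0 < tb) (hcop : Nat.Coprime ta tb)
    (hs : ta + tb ≤ s) (c : Config A B) {i : ℕ} (hi0 : 0 < i) (hi1 : i < A + B) :
    hmax ta tb (c.update s i) ≤ hmax ta tb c := by
  rw [update]
  split_ifs with hact
  · rw [hmax_le_iff]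
    intro z hz0 hz1
    rcases eq_or_ne z i with rfl | hzi
    swap
    · rw [ht_flip_of_ne ta tb c hi0 hzi]
      exact c.ht_le_hmax hz0 hz1
    rw [ht_flip_self ta tb c hi0 hi1]
    have hle := fun (k : ℤ) => c.ht_le_hmax (ta := ta) (tb := tb) (i := k)
    -- Along a residue class modulo ta + tb, a strictly higher site is higher by at least ta + tb.
    -- Applied at distance ta + tb ≤ s, this gives a site as high as the flipped one.
    have hdvd : ∀ k : ℤ, 0 ≤ k → k ≤ (A + B : ℕ) → ((ta : ℤ) + tb) ∣ k - i →
        c.ht ta tb i < c.ht ta tb k → c.ht ta tb i + (ta + tb) ≤ c.ht ta tb k := by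
      intro k hk0 hk1 hk hlt
      obtain ⟨e, he⟩ := ((c.dvd_ht_sub (ta := ta) (tb := tb) hk0 hk1).sub
        (c.dvd_ht_sub hz0 hz1)).add (hk.mul_left ta)
      have h1 : c.ht ta tb k - c.ht ta tb i = (ta + tb) * e := by linarith
      have : 0 < e := by by_contra hcon; nlinarith
      nlinarith
    rcases Active.cases hta htb hcop (by omega) hi0 hi1 hact with ⟨h1, h2, h3⟩ | ⟨h1, h2⟩
    · suffices h : ∃ k : ℤ, 0 ≤ k ∧ k ≤ (A + B : ℕ) ∧
          c.ht ta tb i + (ta + tb) ≤ c.ht ta tb k by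
        obtain ⟨k, hk0, hk1, hk⟩ := h
        have := hle k hk0 hk1
        linarith
      rcases h3 with ⟨h3, h4 | ⟨j, hj0, hj1, hj⟩⟩ | ⟨h3, h4 | ⟨j, hj0, hj1, hj⟩⟩
      · exact ⟨i + (ta + tb), by omega, by omega, hdvd _ (by omega) (by omega) (by simp)
          (h4 _ (by omega) (by omega))⟩
      · exact ⟨i - j, by omega, by omega, hj.elim (fun h => h.le) fun h => h.2.ge⟩
      · exact ⟨i - (ta + tb), by omega, by omega, hdvd _ (by omega) (by omega) ⟨-1, by ring⟩
          (h4 _ (by omega) (by omega))⟩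
      · exact ⟨i + j, by omega, by omega, hj.elim (fun h => h.le) fun h => h.2.ge⟩
    · have := hle i hz0 hz1
      omega
  · exact le_rfl

variable {n : ℕ}

/-- At a site of maximal height no site in sight is higher, so activity only requires full sight on
one side and a low enough site on the other. -/
theorem profile (hta : 0 < ta) (htb : 0 < tb) (hcop : Nat.Coprime ta tb)
    (hs : ta + tb ≤ s) (hsn : 2 * s ≤ n * (ta + tb) + 1) (c : Config (n * ta) (n * tb))
    (hH : (ta : ℤ) + tb ≤ hmax ta tb c) :
    Profile ta (ta + tb) s (n * ta + n * tb : ℕ) (hmax ta tb c) (c.ht ta tb)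
      (fun z => c.Active s z.toNat) where
  T_pos := by omega
  T_le_s := by exact_mod_cast hs
  sight := by rw [mul_add] at hsn; omega
  coprime := by
    have h : Nat.Coprime (ta + tb) ta := by simpa using hcop.symm
    exact_mod_cast Nat.isCoprime_iff_coprime.2 h
  dvd_m := ⟨n, by push_cast; ring⟩
  h_zero := c.ht_zero
  h_end := by rw [c.ht_end]; push_cast; ring
  dvd_h i h0 h1 := c.dvd_ht_sub h0 h1
  le_max i h0 h1 := c.ht_le_hmax h0 h1
  T_le_H := hH
  act_right i j h0 h1 h2 h3 h4 h5 h6 h7 h8 := by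
    lift i to ℕ using h0.le
    lift j to ℕ using by linarith
    rw [Int.toNat_natCast]
    rw [← h2] at h7 h8
    refine active_of_right hta htb hcop (by omega) (by omega) (by omega) (by omega) ?_
      (fun l hl1 hl2 => ?_) (j := j) (by omega) (by omega) (by omega) h7 (h8.imp id fun h => by omega)
    · rw [h2]; exact c.ht_le_hmax (by omega) (by omega)
    · rw [h2]; exact c.ht_le_hmax (by omega) (by omega)
  act_left i j h0 h1 h2 h3 h4 h5 h6 h7 h8 := by
    lift i to ℕ using h0.le
    lift j to ℕ using by linarith
    rw [Int.toNat_natCast]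
    rw [← h2] at h7 h8
    refine active_of_left hta htb hcop (by omega) (by omega) (by omega) (by omega)
      (fun l hl1 hl2 => ?_) ?_ (j := j) (by omega) (by omega) (by omega) h7
      (h8.imp id fun h => by omega)
    · rw [h2]; exact c.ht_le_hmax (by omega) (by omega)
    · rw [h2]; exact c.ht_le_hmax (by omega) (by omega)

end Config

/-! ### The potential and its mean decrease -/

namespace Config

variable {A B : ℕ} {ta tb s n : ℕ}

/-- The weight of the sites of height `H`. -/
noncomputable def weight (ta tb : ℕ) (H : ℤ) (c : Config A B) : ℤ :=
  (runWeight (ta + tb) (levelSet (A + B : ℕ) H (c.ht ta tb)) : ℕ)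

theorem weight_nonneg (H : ℤ) (c : Config A B) : 0 ≤ c.weight ta tb H := Int.natCast_nonneg _

theorem weight_le (H : ℤ) (c : Config A B) : c.weight ta tb H ≤ 2 * (A + B) := by
  have h1 := runWeight_le (ta + tb) (levelSet (A + B : ℕ) H (c.ht ta tb))
  have h2 : (levelSet (A + B : ℕ) H (c.ht ta tb)).card ≤ A + B := by
    refine (Finset.card_filter_le _ _).trans ?_
    rw [Int.card_Ioo]
    omega
  rw [weight]
  omega

/-- The potential of a configuration above the target. -/
noncomputable def potential (ta tb : ℕ) (c : Config A B) : ℤ :=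
  if hmax ta tb c < ta + tb then 0
  else (hmax ta tb c - (ta + tb) + 1) * (2 * (A + B)) ^ 2 +
    c.weight ta tb (hmax ta tb c) * (2 * (2 * (A + B)) - c.weight ta tb (hmax ta tb c))

theorem weight_mul_nonneg (H : ℤ) (c : Config A B) :
    0 ≤ c.weight ta tb H * (2 * (2 * (A + B)) - c.weight ta tb H) := by
  have h1 := c.weight_nonneg (ta := ta) (tb := tb) H
  have h2 := c.weight_le (ta := ta) (tb := tb) H
  exact mul_nonneg h1 (by linarith)

theorem weight_mul_le (H : ℤ) (c : Config A B) :
    c.weight ta tb H * (2 * (2 * (A + B)) - c.weight ta tb H) ≤ (2 * (A + B)) ^ 2 := by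
  nlinarith [sq_nonneg (2 * ((A : ℤ) + B) - c.weight ta tb H)]

theorem potential_nonneg (c : Config A B) : 0 ≤ c.potential ta tb := by
  rw [potential]
  split_ifs with h
  · exact le_rfl
  · have h1 := c.weight_mul_nonneg (ta := ta) (tb := tb) (hmax ta tb c)
    have h2 : 0 ≤ (hmax ta tb c - (ta + tb) + 1) * (2 * ((A : ℤ) + B)) ^ 2 :=
      mul_nonneg (by linarith) (sq_nonneg _)
    linarith

theorem hmax_le (c : Config A B) : hmax ta tb c ≤ ta * B := by
  rw [hmax_le_iff]
  intro i h0 h1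
  have hB : prefB c.word i.toNat ≤ B := by
    have := (List.take_sublist i.toNat c.word).count_le Letter.b
    rwa [c.count_b] at this
  have hB' : (ta : ℤ) * prefB c.word i.toNat ≤ ta * B := by
    exact_mod_cast Nat.mul_le_mul_left ta hB
  have hA : (0 : ℤ) ≤ tb * prefA c.word i.toNat := by positivity
  rw [ht, height, site]
  linarith

theorem potential_le (hta : 0 < ta) (htb : 0 < tb) (c : Config A B) :
    c.potential ta tb ≤ ta * B * (2 * (A + B)) ^ 2 := by
  rw [potential]
  split_ifs with h
  · positivity
  · have h1 := c.weight_mul_le (ta := ta) (tb := tb) (hmax ta tb c)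
    have h2 : (hmax ta tb c - (ta + tb) + 1) * (2 * ((A : ℤ) + B)) ^ 2 ≤
        (ta * B - 1) * (2 * (A + B)) ^ 2 :=
      mul_le_mul_of_nonneg_right (by have := c.hmax_le (ta := ta) (tb := tb); omega) (sq_nonneg _)
    linarith

/-- If the maximum is below H, the saved multiple of K² = (2(A + B))² covers any value of the
concave term at the new level. The level H can thus be kept as reference after a flip. -/
theorem potential_le_of_hmax_le {H : ℤ} (hH : (ta : ℤ) + tb ≤ H) (c : Config A B)
    (hc : hmax ta tb c ≤ H) :
    c.potential ta tb ≤ (H - (ta + tb) + 1) * (2 * (A + B)) ^ 2 +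
      c.weight ta tb H * (2 * (2 * (A + B)) - c.weight ta tb H) := by
  have h0 := c.weight_mul_nonneg (ta := ta) (tb := tb) H
  rw [potential]
  split_ifs with h
  · have h2 : 0 ≤ (H - (ta + tb) + 1) * (2 * ((A : ℤ) + B)) ^ 2 :=
      mul_nonneg (by linarith) (sq_nonneg _)
    linarith
  · rcases hc.lt_or_eq with hlt | heq
    · have h1 := c.weight_mul_le (ta := ta) (tb := tb) (hmax ta tb c)
      have h2 : (hmax ta tb c - (ta + tb) + 1) * (2 * ((A : ℤ) + B)) ^ 2 ≤
          (H - (ta + tb)) * (2 * (A + B)) ^ 2 :=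
        mul_le_mul_of_nonneg_right (by omega) (sq_nonneg _)
      linarith
    · rw [heq]

theorem sum_Icc_eq_sum_Ioo (m : ℕ) (f : ℕ → ℤ) :
    ∑ i ∈ Finset.Icc 1 (m - 1), f i = ∑ z ∈ Finset.Ioo (0 : ℤ) m, f z.toNat := by
  refine Finset.sum_nbij' (fun i => (i : ℤ)) Int.toNat ?_ ?_ ?_ ?_ ?_
  · intro i hi; rw [Finset.mem_Icc] at hi; rw [Finset.mem_Ioo]; omega
  · intro z hz; rw [Finset.mem_Ioo] at hz; rw [Finset.mem_Icc]; omega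
  · intro i _; simp
  · intro z hz; rw [Finset.mem_Ioo] at hz; simp; omega
  · intro i _; simp

theorem potential_update_of_lt (hta : 0 < ta) (htb : 0 < tb) (hcop : Nat.Coprime ta tb)
    (hs : ta + tb ≤ s) (c : Config A B) (hH : hmax ta tb c < ta + tb) {i : ℕ} (hi0 : 0 < i)
    (hi1 : i < A + B) : (c.update s i).potential ta tb = 0 := by
  rw [potential, if_pos ((hmax_update_le hta htb hcop hs c hi0 hi1).trans_lt hH)]

open Classical in
theorem sum_potential_update_of_le (hta : 0 < ta) (htb : 0 < tb) (hcop : Nat.Coprime ta tb)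
    (hs : ta + tb ≤ s) (hsn : 2 * s ≤ n * (ta + tb) + 1) (c : Config (n * ta) (n * tb))
    (hH : (ta : ℤ) + tb ≤ hmax ta tb c) :
    ∑ i ∈ Finset.Icc 1 (n * ta + n * tb - 1), (c.update s i).potential ta tb + 1 ≤
      ∑ _i ∈ Finset.Icc 1 (n * ta + n * tb - 1), c.potential ta tb := by
  have P := c.profile hta htb hcop hs hsn hH
  rw [sum_Icc_eq_sum_Ioo, sum_Icc_eq_sum_Ioo]
  have hT : (0 : ℤ) < ta + tb := by omega
  set H := hmax ta tb c with hHdef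
  set m := n * ta + n * tb with hm
  have hcH : ∀ z, 0 < z → z < (m : ℤ) → c.ht ta tb z ≤ H := fun z h0 h1 =>
    c.ht_le_hmax h0.le h1.le
  have hne : (levelSet m H (c.ht ta tb)).Nonempty := by
    obtain ⟨z, h0, h1, h2⟩ := c.exists_ht_eq_hmax (ta := ta) (tb := tb)
    have e0 := P.h_zero
    have em := P.h_end
    refine ⟨z, mem_levelSet.2 ⟨⟨lt_of_le_of_ne h0 ?_, lt_of_le_of_ne h1 ?_⟩, h2⟩⟩
    · rintro rfl; omega
    · rintro rfl; omega
  have hcases : ∀ z : ℤ, 0 < z → z < m → c.Active s z.toNat → _ := fun z h0 h1 =>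
    Active.cases (c := c) (i := z.toNat) hta htb hcop (by omega) (by omega) (by omega)
  have hflip : ∀ z : ℤ, 0 < z → z < m → c.Active s z.toNat → ∀ x : ℤ,
      (c.update s z.toNat).ht ta tb x = if x = z then
        c.ht ta tb (z - 1) + c.ht ta tb (z + 1) - c.ht ta tb z else c.ht ta tb x := by
    intro z h0 h1 hact x
    have ez : ((z.toNat : ℕ) : ℤ) = z := Int.toNat_of_nonneg h0.le
    rw [update, if_pos hact]
    split_ifs with hx
    · rw [hx]
      have := ht_flip_self ta tb c (i := z.toNat) (by omega) (by omega)
      rwa [ez] at this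
    · exact ht_flip_of_ne ta tb c (by omega) (by rwa [ez])
  -- Among active sites, the condition that the next site is higher singles out the local minima,
  -- whose flip rises by exactly ta + tb.
  let G : Finset ℤ := (Finset.Ioo 0 (m : ℤ)).filter fun z =>
    c.Active s z.toNat ∧ c.ht ta tb z < c.ht ta tb (z + 1) ∧ c.ht ta tb z = H - (ta + tb)
  have hmemG : ∀ z, z ∈ G ↔ (0 < z ∧ z < m) ∧
      c.Active s z.toNat ∧ c.ht ta tb z < c.ht ta tb (z + 1) ∧ c.ht ta tb z = H - (ta + tb) := by
    intro z
    simp only [G, Finset.mem_filter, Finset.mem_Ioo]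
  have hdrift := P.drift hne G (K := 2 * ((n * ta : ℕ) + (n * tb : ℕ)))
    (S' := fun z => levelSet m H ((c.update s z.toNat).ht ta tb)) ?_ ?_ ?_ ?_
    (c.weight_le (ta := ta) (tb := tb) H)
  · have hIoo : ∀ z ∈ Finset.Ioo (0 : ℤ) m, 0 < z.toNat ∧ z.toNat < m := by
      intro z hz
      rw [Finset.mem_Ioo] at hz
      omega
    have h1 := Finset.sum_le_sum (s := Finset.Ioo (0 : ℤ) m) fun z hz =>
      potential_le_of_hmax_le hH (c.update s z.toNat)
        (hmax_update_le hta htb hcop hs c (hIoo z hz).1 (hIoo z hz).2)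
    rw [Finset.sum_add_distrib] at h1
    have h2 : c.potential ta tb = (H - (ta + tb) + 1) * (2 * ((n * ta : ℕ) + (n * tb : ℕ))) ^ 2 +
      c.weight ta tb H * (2 * (2 * ((n * ta : ℕ) + (n * tb : ℕ))) - c.weight ta tb H) := by
      rw [potential, if_neg (not_lt.2 hH)]
    rw [h2, Finset.sum_add_distrib]
    simp only [weight] at h1 ⊢
    linarith
  · intro z hz
    obtain ⟨⟨h0, h1⟩, hact, hlt, heq⟩ := (hmemG z).1 hz
    have ez : ((z.toNat : ℕ) : ℤ) = z := Int.toNat_of_nonneg h0.le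
    refine ⟨h0, h1, heq, ?_⟩
    have hc := hcases z h0 h1 hact
    rw [ez, heq] at hc
    rw [heq] at hlt
    have hbound : ∀ k, 0 ≤ k → k ≤ (m : ℤ) → c.ht ta tb k ≤ H := fun k h0 h1 => c.ht_le_hmax h0 h1
    rcases hc with ⟨-, -, h3⟩ | ⟨-, h4⟩
    · refine h3.imp (fun h3 => ⟨by omega, h3.2.imp id ?_⟩) fun h3 => ⟨by omega, h3.2.imp id ?_⟩
      -- A witness of thickness strictly above H is impossible, so only the one at distance ta + tb
      -- and of height H remains.
      · rintro ⟨j, hj0, hj1, hj | ⟨rfl, hj⟩⟩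
        · have := hbound (z - j) (by omega) (by omega)
          omega
        · exact ⟨by omega, by omega⟩
      · rintro ⟨j, hj0, hj1, hj | ⟨rfl, hj⟩⟩
        · have := hbound (z + j) (by omega) (by omega)
          omega
        · exact ⟨by omega, by omega⟩
    · omega
  · intro z hz hact
    obtain ⟨⟨h0, h1⟩, heq⟩ := mem_levelSet.1 hz
    have ez : ((z.toNat : ℕ) : ℤ) = z := Int.toNat_of_nonneg h0.le
    have hc := hcases z h0 h1 hact
    rw [ez, heq] at hc
    -- A site of maximal height is not a local minimum, so the flip lowers it by ta + tb and takes
    -- it out of the level.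
    have hbl := c.ht_le_hmax (ta := ta) (tb := tb) (i := z - 1) (by omega) (by omega)
    ext x
    rw [Finset.mem_erase, mem_levelSet, mem_levelSet, hflip z h0 h1 hact]
    by_cases hx : x = z
    · rw [if_pos hx, heq]
      omega
    · rw [if_neg hx]
      tauto
  · intro z hz
    obtain ⟨⟨h0, h1⟩, hact, hlt, heq⟩ := (hmemG z).1 hz
    have ez : ((z.toNat : ℕ) : ℤ) = z := Int.toNat_of_nonneg h0.le
    have hc := hcases z h0 h1 hact
    rw [ez] at hc
    ext x
    rw [Finset.mem_insert, mem_levelSet, mem_levelSet, hflip z h0 h1 hact]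
    by_cases hx : x = z
    · rw [if_pos hx, hx]
      omega
    · rw [if_neg hx]
      tauto
  · intro z hz hS hG
    obtain ⟨h0, h1⟩ := Finset.mem_Ioo.1 hz
    have ez : ((z.toNat : ℕ) : ℤ) = z := Int.toNat_of_nonneg h0.le
    by_cases hact : c.Active s z.toNat
    · have hc := hcases z h0 h1 hact
      rw [ez] at hc
      have hzS : c.ht ta tb z ≠ H := fun hh => hS ⟨mem_levelSet.2 ⟨⟨h0, h1⟩, hh⟩, hact⟩
      have hzH := hcH z h0 h1
      rw [hmemG] at hG
      ext x
      rw [mem_levelSet, mem_levelSet, hflip z h0 h1 hact]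
      by_cases hx : x = z
      · rw [if_pos hx, hx]
        -- A flip at a local maximum goes down from at most H, and one at a local minimum reaches H
        -- only from H - (ta + tb), which would put z in `G`.
        have : c.ht ta tb (z - 1) + c.ht ta tb (z + 1) - c.ht ta tb z ≠ H := by
          intro hh
          rcases hc with ⟨h3, h4, -⟩ | ⟨h3, h4⟩
          · exact hG ⟨⟨h0, h1⟩, hact, by omega, by omega⟩
          · omega
        tauto
      · rw [if_neg hx]
    · simp only [update, if_neg hact]

end Config

/-! ### Exchange of the letters and the two-sided potential -/

theorem swapAt_swapWord (k : ℕ) (w : List Letter) :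
    swapAt k (swapWord w) = swapWord (swapAt k w) := by
  induction k generalizing w with
  | zero =>
    match w with
    | [] => rfl
    | [_] => rfl
    | _ :: _ :: _ => rfl
  | succ k ih =>
    match w with
    | [] => rfl
    | x :: w => exact congrArg (x.swap :: ·) (ih w)

namespace Config

variable {A B : ℕ} {ta tb s n : ℕ}

/-- The reflected path, obtained by exchanging the letters. -/
def swap (c : Config A B) : Config B A where
  word := swapWord c.word
  count_a := (count_swapWord c.word).1.trans c.count_b
  count_b := (count_swapWord c.word).2.trans c.count_a

theorem ht_swap (c : Config A B) (z : ℤ) : c.swap.ht tb ta z = -c.ht ta tb z := by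
  simp only [ht, height, site, swap, prefA_swapWord, prefB_swapWord]
  ring

theorem hmin_eq_neg_hmax_swap (c : Config A B) : hmin ta tb c = -hmax tb ta c.swap := by
  apply le_antisymm
  · obtain ⟨i, h0, h1, h2⟩ := c.swap.exists_ht_eq_hmax (ta := tb) (tb := ta)
    rw [← h2, ht_swap, neg_neg]
    lift i to ℕ using h0
    exact Finset.inf'_le (fun i => height ta tb (c.site i)) (Finset.mem_range.2 (by omega))
  · refine Finset.le_inf' _ _ fun i hi => ?_
    rw [Finset.mem_range] at hi
    have := c.swap.ht_le_hmax (ta := tb) (tb := ta) (i := i) (by omega) (by omega)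
    rw [ht_swap, ht_natCast] at this
    linarith

theorem active_swap (s : ℕ) (c : Config A B) (i : ℕ) : c.swap.Active s i ↔ c.Active s i := by
  have h1 : c.swap.leftWord s i = swapWord (c.leftWord s i) := by
    simp only [leftWord, swap, swapWord, List.map_take, List.map_reverse]
  have h2 : c.swap.rightWord s i = swapWord (c.rightWord s i) := by
    simp only [rightWord, swap, swapWord, List.map_take, List.map_drop]
  rw [Active, h1, h2, rule_swapWord, Active]

theorem update_swap (s : ℕ) (c : Config A B) (i : ℕ) :
    c.swap.update s i = (c.update s i).swap := by
  by_cases h : c.Active s i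
  · rw [update, update, if_pos h, if_pos ((active_swap s c i).2 h)]
    ext1
    exact swapAt_swapWord _ _
  · rw [update, update, if_neg h, if_neg (mt (active_swap s c i).1 h)]

theorem mem_nearLine_iff (hta : 0 < ta) (htb : 0 < tb) (hAB : 0 < A + B) (c : Config A B) :
    c ∈ nearLine ta tb A B ↔
      hmax ta tb c < ta + tb ∧ hmax tb ta c.swap < tb + ta := by
  have hlt : hmin ta tb c < hmax ta tb c := by
    have h1 := c.ht_le_hmax (ta := ta) (tb := tb) (i := 1) (by omega) (by omega)
    have h2 := c.swap.ht_le_hmax (ta := tb) (tb := ta) (i := 1) (by omega) (by omega)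
    have h3 := c.ht_le_hmax (ta := ta) (tb := tb) (i := 0) (by omega) (by omega)
    have h4 := c.swap.ht_le_hmax (ta := tb) (tb := ta) (i := 0) (by omega) (by omega)
    rw [ht_swap] at h2 h4
    rw [ht_zero] at h3 h4
    -- The first step changes the height by -tb or ta, so the strict inequality between the extreme
    -- heights is automatic.
    have h5 : c.ht ta tb 1 ≠ 0 := by
      have h := prefA_add_prefB c.word (j := 1) (by rw [length_word]; omega)
      have e : c.ht ta tb 1 = -(tb : ℤ) * prefA c.word 1 + ta * prefB c.word 1 := rfl
      rw [e]
      rcases Nat.eq_zero_or_pos (prefA c.word 1) with h0 | h0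
      · rw [h0, show prefB c.word 1 = 1 by omega]
        push_cast
        omega
      · rw [show prefA c.word 1 = 1 by omega, show prefB c.word 1 = 0 by omega]
        push_cast
        omega
    rw [hmin_eq_neg_hmax_swap]
    omega
  rw [hmin_eq_neg_hmax_swap] at hlt
  simp only [nearLine, Set.mem_ofPred_eq, hmin_eq_neg_hmax_swap]
  omega

/-- The potential of a configuration, above and below the line. -/
noncomputable def totalPotential (ta tb : ℕ) (c : Config A B) : ℕ :=
  (c.potential ta tb + c.swap.potential tb ta).toNat

theorem coe_totalPotential (c : Config A B) :
    (c.totalPotential ta tb : ℤ) = c.potential ta tb + c.swap.potential tb ta :=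
  Int.toNat_of_nonneg (add_nonneg c.potential_nonneg c.swap.potential_nonneg)

theorem totalPotential_le (hta : 0 < ta) (htb : 0 < tb) (c : Config (n * ta) (n * tb)) :
    c.totalPotential ta tb ≤ 8 * (ta * tb) * (ta + tb) ^ 2 * n ^ 3 := by
  have h1 := c.potential_le hta htb
  have h2 := c.swap.potential_le htb hta
  zify
  rw [coe_totalPotential]
  push_cast at h1 h2
  linarith

theorem sum_potential_update_le (hta : 0 < ta) (htb : 0 < tb) (hcop : Nat.Coprime ta tb)
    (hs : ta + tb ≤ s) (hsn : 2 * s ≤ n * (ta + tb) + 1) (c : Config (n * ta) (n * tb)) :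
    ∑ i ∈ Finset.Icc 1 (n * ta + n * tb - 1), (c.update s i).potential ta tb +
      (if hmax ta tb c < ta + tb then 0 else 1) ≤
      ∑ _i ∈ Finset.Icc 1 (n * ta + n * tb - 1), c.potential ta tb := by
  split_ifs with h
  · rw [add_zero]
    refine Finset.sum_le_sum fun i hi => ?_
    rw [Finset.mem_Icc] at hi
    rw [potential_update_of_lt hta htb hcop hs c h (by omega) (by omega)]
    exact c.potential_nonneg
  · exact sum_potential_update_of_le hta htb hcop hs hsn c (not_lt.1 h)

/-- Neither one-sided potential increases in mean, and off the target at least one of them is in its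
regime of strict decrease. -/
theorem sum_totalPotential_update_le (hta : 0 < ta) (htb : 0 < tb) (hcop : Nat.Coprime ta tb)
    (hs : ta + tb ≤ s) (hsn : 2 * s ≤ n * (ta + tb) + 1) (c : Config (n * ta) (n * tb))
    (hc : c ∉ nearLine ta tb (n * ta) (n * tb)) :
    ∑ i ∈ Finset.Icc 1 (n * ta + n * tb - 1), (c.update s i).totalPotential ta tb + 1 ≤
      (n * ta + n * tb - 1) * c.totalPotential ta tb := by
  have h1 := sum_potential_update_le hta htb hcop hs hsn c
  have h2 := sum_potential_update_le (s := s) htb hta hcop.symm (by omega) (by rwa [add_comm tb]) c.swap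
  rw [add_comm (n * tb)] at h2
  have hAB : 0 < n * ta + n * tb := by rw [← mul_add]; omega
  rw [mem_nearLine_iff hta htb hAB] at hc
  have hcard : ∑ _i ∈ Finset.Icc 1 (n * ta + n * tb - 1), c.totalPotential ta tb =
      (n * ta + n * tb - 1) * c.totalPotential ta tb := by
    rw [Finset.sum_const, Nat.card_Icc, smul_eq_mul, Nat.add_sub_cancel]
  rw [← hcard]
  zify
  simp only [coe_totalPotential, Finset.sum_add_distrib, update_swap] at h2 ⊢
  split_ifs at h1 h2 <;> first | linarith | exact absurd ⟨‹_›, ‹_›⟩ hc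

theorem finite (A B : ℕ) : Finite (Config A B) := by
  have : Finite Letter := Finite.of_injective (fun x => decide (x = Letter.a)) (by
    intro x y; cases x <;> cases y <;> simp)
  have : Finite {l : List Letter | l.length = A + B} := List.finite_length_eq Letter (A + B)
  exact Finite.of_injective
    (fun c : Config A B => (⟨c.word, c.length_word⟩ : {l : List Letter | l.length = A + B}))
    fun c d h => Config.ext (congrArg Subtype.val h)

instance (A B : ℕ) : MeasurableSingletonClass (Config A B) := ⟨fun _ => trivial⟩

theorem sum_transProb_mul {A B : ℕ} [Fintype (Config A B)] (s : ℕ) (c : Config A B)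
    (hAB : 1 < A + B) (V : Config A B → ℝ≥0∞) :
    ((A + B - 1 : ℕ) : ℝ≥0∞) * ∑ c', transProb s c c' * V c' =
      ∑ i ∈ Finset.Icc 1 (A + B - 1), V (c.update s i) := by
  classical
  have h0 : ((A + B - 1 : ℕ) : ℝ≥0∞) ≠ 0 := by
    rw [Nat.cast_ne_zero]; omega
  rw [Finset.mul_sum, ← Finset.sum_fiberwise (Finset.Icc 1 (A + B - 1)) (fun i => c.update s i)]
  refine Finset.sum_congr rfl fun c' _ => ?_
  rw [transProb, ← mul_assoc, ENNReal.mul_div_cancel h0 (ENNReal.natCast_ne_top _)]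
  rw [Finset.sum_congr rfl (g := fun _ => V c') fun i hi => by rw [(Finset.mem_filter.1 hi).2],
    Finset.sum_const, nsmul_eq_mul]

end Config

/-! ### Hitting times of finite Markov chains from a drift condition -/

section MarkovChain

variable {Ω α : Type*} [MeasurableSpace Ω] [MeasurableSpace α]
  [MeasurableSingletonClass α]

theorem measurableSet_cylinder {X : ℕ → Ω → α} (hX : ∀ t, Measurable (X t)) (t : ℕ) (x : ℕ → α) :
    MeasurableSet {ω | ∀ k ≤ t, X k ω = x k} := by
  simp only [Set.ofPred_forall]
  exact MeasurableSet.iInter fun k => MeasurableSet.iInter fun _ =>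
    hX k (measurableSet_singleton (x k))

variable [Fintype α]

theorem measurableSet_notHit {X : ℕ → Ω → α} (hX : ∀ t, Measurable (X t)) (G : Set α) (t : ℕ) :
    MeasurableSet {ω | ∀ k ≤ t, X k ω ∉ G} := by
  simp only [Set.ofPred_forall]
  exact MeasurableSet.iInter fun k => MeasurableSet.iInter fun _ =>
    hX k (Set.toFinite Gᶜ).measurableSet

/-- Given the first values of a Markov chain, the mean of a function of the next value. -/
theorem setLIntegral_cylinder {μ : Measure Ω} {X : ℕ → Ω → α} (hX : ∀ t, Measurable (X t))
    {p : α → α → ℝ≥0∞}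
    (hp : ∀ (t : ℕ) (x : ℕ → α), μ {ω | ∀ k ≤ t + 1, X k ω = x k} =
      μ {ω | ∀ k ≤ t, X k ω = x k} * p (x t) (x (t + 1)))
    (V : α → ℝ≥0∞) (t : ℕ) (x : ℕ → α) :
    ∫⁻ ω in {ω | ∀ k ≤ t, X k ω = x k}, V (X (t + 1) ω) ∂μ =
      (∑ y, p (x t) y * V y) * μ {ω | ∀ k ≤ t, X k ω = x k} := by
  classical
  have h1 : ∀ ω, V (X (t + 1) ω) = ∑ y, (X (t + 1) ⁻¹' {y}).indicator (fun _ => V y) ω := by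
    intro ω
    rw [Finset.sum_eq_single (X (t + 1) ω)]
    · simp
    · intro y _ hy
      have h : ω ∉ X (t + 1) ⁻¹' {y} := fun h => hy (Set.mem_singleton_iff.1 h).symm
      exact Set.indicator_of_notMem h _
    · simp
  simp only [h1]
  rw [lintegral_finsetSum _ fun y _ =>
    measurable_const.indicator (hX _ (measurableSet_singleton y)), Finset.sum_mul]
  refine Finset.sum_congr rfl fun y _ => ?_
  rw [lintegral_indicator_const (hX _ (measurableSet_singleton y)),
    Measure.restrict_apply (hX _ (measurableSet_singleton y))]
  -- Prescribing the value y at time t + 1 leaves the cylinder up to time t unchanged.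
  have h2 := hp t (Function.update x (t + 1) y)
  rw [Function.update_self, Function.update_of_ne (by omega)] at h2
  have h3 : {ω | ∀ k ≤ t, X k ω = Function.update x (t + 1) y k} = {ω | ∀ k ≤ t, X k ω = x k} := by
    ext ω
    refine forall₂_congr fun k hk => ?_
    rw [Function.update_of_ne (by omega)]
  have h4 : {ω | ∀ k ≤ t + 1, X k ω = Function.update x (t + 1) y k} =
      X (t + 1) ⁻¹' {y} ∩ {ω | ∀ k ≤ t, X k ω = x k} := by
    rw [← h3]
    ext ω
    constructor
    · intro h
      exact ⟨by simpa using h (t + 1) le_rfl, fun k hk => h k (by omega)⟩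
    · rintro ⟨h, h'⟩ k hk
      rcases Nat.le_succ_iff.1 hk with hk | rfl
      · exact h' k hk
      · simpa using h
  rw [← h4, h2, h3]
  ring

/-- The event of not having hit `G` by time t is a disjoint union of cylinders. On each of them the
drift condition applies at the last prescribed value, which is outside `G`. -/
theorem setLIntegral_notHit_add_le {μ : Measure Ω} {X : ℕ → Ω → α} (hX : ∀ t, Measurable (X t))
    {p : α → α → ℝ≥0∞}
    (hp : ∀ (t : ℕ) (x : ℕ → α), μ {ω | ∀ k ≤ t + 1, X k ω = x k} =
      μ {ω | ∀ k ≤ t, X k ω = x k} * p (x t) (x (t + 1)))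
    {G : Set α} {V : α → ℝ≥0∞} {M : ℝ≥0∞}
    (hV : ∀ x ∉ G, M * ∑ y, p x y * V y + 1 ≤ M * V x) (t : ℕ) :
    ∫⁻ ω in {ω | ∀ k ≤ t, X k ω ∉ G}, (M * V (X (t + 1) ω) + 1) ∂μ ≤
      ∫⁻ ω in {ω | ∀ k ≤ t, X k ω ∉ G}, M * V (X t ω) ∂μ := by
  -- Tuples are extended periodically to sequences; the values after time t play no role.
  let e : (Fin (t + 1) → α) → ℕ → α := fun y k => y (Fin.ofNat (t + 1) k)
  have he : ∀ (y : Fin (t + 1) → α) (ω : Ω),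
      (∀ k ≤ t, X k ω = e y k) ↔ ∀ k : Fin (t + 1), X k ω = y k := by
    intro y ω
    constructor
    · intro h k
      rw [h k (by omega)]
      simp [e]
    · intro h k hk
      have := h (Fin.ofNat (t + 1) k)
      rwa [Fin.val_ofNat, Nat.mod_eq_of_lt (by omega)] at this
  let C : {y : Fin (t + 1) → α // ∀ k, y k ∉ G} → Set Ω := fun y => {ω | ∀ k ≤ t, X k ω = e y.1 k}
  have hC : {ω | ∀ k ≤ t, X k ω ∉ G} = ⋃ y, C y := by
    ext ω
    rw [Set.mem_iUnion]
    constructor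
    · intro h
      exact ⟨⟨fun k => X k ω, fun k => h k (by omega)⟩, (he _ ω).2 fun k => rfl⟩
    · rintro ⟨y, hy⟩ k hk
      have := hy k hk
      rw [this]
      exact y.2 _
  have hCm : ∀ y, MeasurableSet (C y) := fun y => measurableSet_cylinder hX t _
  have hCd : Pairwise (Function.onFun Disjoint C) := by
    intro y z hyz
    refine Set.disjoint_left.2 fun ω h1 h2 => hyz (Subtype.ext (funext fun k => ?_))
    rw [← (he y.1 ω).1 h1 k, ← (he z.1 ω).1 h2 k]
  rw [hC, lintegral_iUnion hCm hCd, lintegral_iUnion hCm hCd]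
  refine ENNReal.tsum_le_tsum fun y => ?_
  have hVm : ∀ k, Measurable fun ω => V (X k ω) := fun k => (measurable_of_finite V).comp (hX k)
  rw [lintegral_add_left ((hVm _).const_mul M), lintegral_const_mul _ (hVm _),
    setLIntegral_cylinder hX hp, setLIntegral_one,
    setLIntegral_congr_fun (g := fun _ => M * V (e y.1 t)) (hCm y)
      (fun ω hω => by simp only [hω t le_rfl]), setLIntegral_const, ← mul_assoc]
  calc M * (∑ z, p (e y.1 t) z * V z) * μ (C y) + μ (C y)
      = (M * (∑ z, p (e y.1 t) z * V z) + 1) * μ (C y) := by ring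
    _ ≤ M * V (e y.1 t) * μ (C y) := by gcongr; exact hV _ (y.2 _)

/-- A bound on the hitting time of a set by a Markov chain from a function that decreases in
mean as long as the set is not hit. -/
theorem hitTime_of_drift {μ : Measure Ω} [IsProbabilityMeasure μ] {X : ℕ → Ω → α}
    (hX : ∀ t, Measurable (X t)) {p : α → α → ℝ≥0∞}
    (hp : ∀ (t : ℕ) (x : ℕ → α), μ {ω | ∀ k ≤ t + 1, X k ω = x k} =
      μ {ω | ∀ k ≤ t, X k ω = x k} * p (x t) (x (t + 1)))
    {G : Set α} {V : α → ℝ≥0∞} {M b : ℝ≥0∞}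
    (hV : ∀ x ∉ G, M * ∑ y, p x y * V y + 1 ≤ M * V x) (hb : ∀ x, M * V x ≤ b) (hbt : b ≠ ∞) :
    (∀ᵐ ω ∂μ, ∃ t, X t ω ∈ G) ∧ ∫⁻ ω, hitTime X G ω ∂μ ≤ b := by
  let Q : ℕ → Set Ω := fun t => {ω | ∀ k ≤ t, X k ω ∉ G}
  have hQm : ∀ t, MeasurableSet (Q t) := fun t => measurableSet_notHit hX G t
  have hVm : ∀ k, Measurable fun ω => V (X k ω) := fun k => (measurable_of_finite V).comp (hX k)
  have hstep : ∀ t, ∫⁻ ω in Q (t + 1), M * V (X (t + 1) ω) ∂μ + μ (Q t) ≤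
      ∫⁻ ω in Q t, M * V (X t ω) ∂μ := by
    intro t
    refine le_trans ?_ (setLIntegral_notHit_add_le hX hp hV t)
    rw [lintegral_add_left ((hVm _).const_mul M), setLIntegral_one]
    gcongr
    exact fun ω hω k hk => hω k (by omega)
  -- The drift inequality telescopes. The initial law enters only through the uniform bound b.
  have hsum : ∀ N, ∑ t ∈ Finset.range N, μ (Q t) + ∫⁻ ω in Q N, M * V (X N ω) ∂μ ≤ b := by
    intro N
    induction N with
    | zero =>
      rw [Finset.sum_range_zero, zero_add]
      refine (lintegral_mono fun ω => hb _).trans ?_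
      rw [setLIntegral_const]
      exact (mul_le_mul_right prob_le_one b).trans_eq (mul_one b)
    | succ N ih =>
      rw [Finset.sum_range_succ, add_assoc, add_comm (μ (Q N))]
      exact (add_le_add_right (hstep N) _).trans ih
  -- The hitting time as the number of times t such that `G` has not been visited up to t. It is
  -- infinite if `G` is never visited, so finiteness of its mean also gives the almost sure
  -- statement.
  let τ : Ω → ℝ≥0∞ := fun ω => ∑' t, (Q t).indicator (fun _ => 1) ω
  have hτm : ∀ t, Measurable ((Q t).indicator fun _ => (1 : ℝ≥0∞)) := fun t =>
    measurable_const.indicator (hQm t)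
  have hτ : ∫⁻ ω, τ ω ∂μ ≤ b := by
    rw [lintegral_tsum fun t => (hτm t).aemeasurable]
    simp only [lintegral_indicator_const (hQm _), one_mul]
    exact ENNReal.tsum_le_of_sum_range_le fun N => le_self_add.trans (hsum N)
  have htop : ∀ ω, (¬ ∃ t, X t ω ∈ G) → τ ω = ∞ := by
    intro ω hω
    push Not at hω
    have : ∀ t, (Q t).indicator (fun _ => (1 : ℝ≥0∞)) ω = 1 := fun t =>
      Set.indicator_of_mem (show ω ∈ Q t from fun k _ => hω k) _
    simp only [τ, this]
    exact ENNReal.tsum_const_eq_top_of_ne_zero one_ne_zero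
  have hle : ∀ ω, hitTime X G ω ≤ τ ω := by
    classical
    intro ω
    by_cases h : ∃ t, X t ω ∈ G
    · refine (iInf₂_le (Nat.find h) (Nat.find_spec h)).trans ?_
      refine le_trans (le_of_eq ?_) (ENNReal.sum_le_tsum (Finset.range (Nat.find h)))
      rw [Finset.sum_congr rfl (g := fun _ => (1 : ℝ≥0∞))]
      · simp
      · intro t ht
        exact Set.indicator_of_mem (show ω ∈ Q t from fun k hk hG =>
          Nat.find_min h (hk.trans_lt (Finset.mem_range.1 ht)) hG) _
    · rw [htop ω h]
      exact le_top
  refine ⟨?_, (lintegral_mono hle).trans hτ⟩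
  filter_upwards [ae_lt_top (Measurable.tsum hτm) (ne_top_of_le_ne_top hbt hτ)] with ω hω
  by_contra h
  exact hω.ne (htop ω h)

end MarkovChain

end LatticeThread

/-! ### The bound on the hitting time -/

theorem mainTheorem2 (ta tb : ℕ) (hta : 0 < ta) (htb : 0 < tb) (hcop : Nat.Coprime ta tb) :
    ∃ C : ℝ≥0, ∀ (s n : ℕ), ta + tb ≤ s → 2 * s ≤ n * (ta + tb) + 1 →
      ∀ {Ω : Type*} [MeasurableSpace Ω] (μ : Measure Ω) [IsProbabilityMeasure μ]
        (X : ℕ → Ω → LatticeThread.Config (n * ta) (n * tb)),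
        LatticeThread.IsProcess μ s X →
          (∀ᵐ ω ∂μ, ∃ t : ℕ, X t ω ∈ LatticeThread.nearLine ta tb (n * ta) (n * tb)) ∧
          ∫⁻ ω, LatticeThread.hitTime X (LatticeThread.nearLine ta tb (n * ta) (n * tb)) ω ∂μ ≤
            (C : ℝ≥0∞) * (n : ℝ≥0∞) ^ 4 := by
  -- The constant is the factor in the potential bound 8 ta tb (ta + tb)² n³ times the factor ta +
  -- tb in m = n(ta + tb).
  refine ⟨(8 * (ta * tb) * (ta + tb) ^ 3 : ℕ), fun s n hs hsn Ω _ μ _ X hX => ?_⟩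
  have := LatticeThread.Config.finite (n * ta) (n * tb)
  have := Fintype.ofFinite (LatticeThread.Config (n * ta) (n * tb))
  have hm : 1 < n * ta + n * tb := by rw [← mul_add]; omega
  refine LatticeThread.hitTime_of_drift hX.measurable hX.markov
    (V := fun c => (c.totalPotential ta tb : ℝ≥0∞)) (M := ((n * ta + n * tb - 1 : ℕ) : ℝ≥0∞))
    (fun c hc => ?_) (fun c => ?_)
    (ENNReal.mul_ne_top ENNReal.coe_ne_top (ENNReal.pow_ne_top (ENNReal.natCast_ne_top n)))
  · rw [LatticeThread.Config.sum_transProb_mul s c hm]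
    exact_mod_cast LatticeThread.Config.sum_totalPotential_update_le hta htb hcop hs hsn c hc
  · have h1 := c.totalPotential_le hta htb
    have h2 : (n * ta + n * tb - 1) * c.totalPotential ta tb ≤
        8 * (ta * tb) * (ta + tb) ^ 3 * n ^ 4 := by
      calc (n * ta + n * tb - 1) * c.totalPotential ta tb
          ≤ (n * ta + n * tb) * (8 * (ta * tb) * (ta + tb) ^ 2 * n ^ 3) :=
            Nat.mul_le_mul (Nat.sub_le _ _) h1
        _ = 8 * (ta * tb) * (ta + tb) ^ 3 * n ^ 4 := by ring
    exact_mod_cast h2
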